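/- Let $\alpha\in(0,1]$, $\lambda,\mu>0$, $\theta=\lambda+\mu$ and $p=\lambda/\theta$. Consider a fractional simple birth-death (M/M/1) process with arrival rate $\lambda$ and service rate $\mu$, with any initial state, in the following sense (the same sojourn and transition law is used in every state, that is, the boundary effect of an empty queue is disregarded): the successive inter-event times $S_1,S_2,\dots$ are i.i.d. with the Mittag-Leffler density $\theta t^{\alpha-1}E_{\alpha,\alpha}(-\theta t^\alpha)$ for $t>0$, where $E_{\alpha,\beta}(x)=\sum_{j\ge0}x^j/\Gamma(\alpha j+\beta)$; the process is constant between consecutive events; and each event is a birth (state $+1$) with probability $p$ and a death (state $-1$) with probability $1-p$, independently of the other events and of all inter-event times. From the first $n$ events, let $n_D$ be the number of deaths, let $\bar L_n$ be the sample mean of $\ln S_1,\dots,\ln S_n$, and let $V_n$ be their sample variance (with divisor $n$ or $n-1$; the claim holds for each choice). With $\gamma$ the Euler-Mascheroni constant put $$\widehat\alpha=\frac{\pi}{\sqrt{3(V_n+\pi^2/6)}},\qquad \widehat\theta=\exp\bigl(-\widehat\alpha(\bar L_n+\gamma)\bigr),\qquad \widehat\mu=\frac{n_D}{n}\,\widehat\theta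 .$$ Then, as $n\to\infty$, $$\sqrt n\,(\widehat\mu-\mu)\ \xrightarrow{\ d\ }\ N\bigl(0,\ \theta^2p(1-p)+(1-p)^2\sigma_\theta^2\bigr),$$ where $$\sigma_\theta^2=\frac{\theta^2\bigl[20\pi^4(2-\alpha^2)-3\pi^2(\alpha^4+20\alpha^2-32)(\ln\theta)^2-720\,\alpha^3(\ln\theta)\,\zeta(3)\bigr]}{120\pi^2}\ \ge 0,$$ and $\zeta(3)$ is the Riemann zeta function at $3$. -/

import Mathlib

open MeasureTheory ProbabilityTheory Filter Topology
open scoped ENNReal NNReal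

namespace FractionalQueue

noncomputable section

/-- The two-parameter Mittag-Leffler function `E_{α,β}(x) = ∑ xʲ / Γ(α j + β)`, for real `x`. -/
def mittagLeffler (α β x : ℝ) : ℝ :=
  ∑' j : ℕ, x ^ j / Real.Gamma (α * j + β)

/-- The Mittag-Leffler density `t ↦ θ t^(α-1) E_{α,α}(-θ t^α)` (used for `t > 0`). -/
def mittagLefflerDensity (α θ t : ℝ) : ℝ :=
  θ * t ^ (α - 1) * mittagLeffler α α (-(θ * t ^ α))

/-- `ν` is the Mittag-Leffler distribution on `(0, ∞)` with index `α` and rate `θ`: the probability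
measure whose distribution function on `[0, ∞)` is the integral of the density above.
(For `t = 0` this says that `ν` gives no mass to `(-∞, 0]`.) -/
def IsMittagLefflerLaw (α θ : ℝ) (ν : Measure ℝ) : Prop :=
  IsProbabilityMeasure ν ∧
    ∀ t : ℝ, 0 ≤ t → ν.real (Set.Iic t) = ∫ u in (0 : ℝ)..t, mittagLefflerDensity α θ u

variable {Ω : Type*}

/-- The time `S 0 + ⋯ + S (k-1)` of the `k`-th event, when `S j` is the `j`-th inter-event time. -/
def eventTime (S : ℕ → Ω → ℝ) (k : ℕ) (ω : Ω) : ℝ :=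
  ∑ j ∈ Finset.range k, S j ω

/-- The change of state at the `(k+1)`-st event: `1` for a birth, `-1` for a death. -/
def step (N : ℝ → Ω → ℤ) (S : ℕ → Ω → ℝ) (k : ℕ) (ω : Ω) : ℤ :=
  N (eventTime S (k + 1) ω) ω - N (eventTime S k ω) ω

/-- `N` is a path model of the fractional simple birth-death (M/M/1) process with index `α`, arrival
rate `lam` and service rate `mu`, and `S` is its sequence of inter-event times: `N` is constant
between consecutive events, the inter-event times are i.i.d. Mittag-Leffler with rate `lam + mu`,
and each event is, independently of everything else, a birth with probability `lam / (lam + mu)`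
and a death with probability `mu / (lam + mu)`. The initial state is arbitrary. -/
structure IsFractionalBirthDeath [MeasurableSpace Ω] (P : Measure Ω) (α lam mu : ℝ)
    (N : ℝ → Ω → ℤ) (S : ℕ → Ω → ℝ) : Prop where
  measurable_sojourn : ∀ k, Measurable (S k)
  measurable_step : ∀ k, Measurable (step N S k)
  path : ∀ᵐ ω ∂P, ∀ (k : ℕ) (t : ℝ), eventTime S k ω ≤ t → t < eventTime S (k + 1) ω →
    N t ω = N (eventTime S k ω) ω
  sojourn_law : ∀ k, IsMittagLefflerLaw α (lam + mu) (P.map (S k))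
  birth_prob : ∀ k, P.real {ω | step N S k ω = 1} = lam / (lam + mu)
  death_prob : ∀ k, P.real {ω | step N S k ω = -1} = mu / (lam + mu)
  indep_sojourn : iIndepFun S P
  indep_step : iIndepFun (step N S) P
  indep_sojourn_step : IndepFun (fun ω k => S k ω) (fun ω k => step N S k ω) P

/-- The number `n_D` of deaths among the first `n` events. -/
def numDeaths (N : ℝ → Ω → ℤ) (S : ℕ → Ω → ℝ) (n : ℕ) (ω : Ω) : ℕ :=
  ((Finset.range n).filter fun k => step N S k ω = -1).card

/-- The sample mean of the log inter-event times. -/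
def logMean (S : ℕ → Ω → ℝ) (n : ℕ) (ω : Ω) : ℝ :=
  (∑ k ∈ Finset.range n, Real.log (S k ω)) / n

/-- The sample variance of the log inter-event times, with divisor `n - d`
(`d = 1` is the unbiased version, `d = 0` the plain second central moment). -/
def logVar (d : ℕ) (S : ℕ → Ω → ℝ) (n : ℕ) (ω : Ω) : ℝ :=
  (∑ k ∈ Finset.range n, (Real.log (S k ω) - logMean S n ω) ^ 2) / ((n : ℝ) - d)

/-- The method-of-moments estimator of `α`. -/
def alphaHat (d : ℕ) (S : ℕ → Ω → ℝ) (n : ℕ) (ω : Ω) : ℝ :=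
  Real.pi / Real.sqrt (3 * (logVar d S n ω + Real.pi ^ 2 / 6))

/-- The estimator of `θ = lam + mu`. -/
def thetaHat (d : ℕ) (S : ℕ → Ω → ℝ) (n : ℕ) (ω : Ω) : ℝ :=
  Real.exp (-(alphaHat d S n ω * (logMean S n ω + Real.eulerMascheroniConstant)))

/-- The estimator `(n_D / n) * thetaHat` of `mu`. -/
def muHat (d : ℕ) (N : ℝ → Ω → ℤ) (S : ℕ → Ω → ℝ) (n : ℕ) (ω : Ω) : ℝ :=
  (numDeaths N S n ω : ℝ) / n * thetaHat d S n ω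

/-- The asymptotic variance `σ_θ²` of `thetaHat`. -/
def sigmaThetaSq (α θ : ℝ) : ℝ :=
  θ ^ 2 * (20 * Real.pi ^ 4 * (2 - α ^ 2)
      - 3 * Real.pi ^ 2 * (α ^ 4 + 20 * α ^ 2 - 32) * Real.log θ ^ 2
      - 720 * α ^ 3 * Real.log θ * (riemannZeta 3).re) / (120 * Real.pi ^ 2)

/-- The asymptotic variance `θ² p (1 - p) + (1 - p)² σ_θ²` of `muHat`. -/
def muVariance (α θ p : ℝ) : ℝ :=
  θ ^ 2 * p * (1 - p) + (1 - p) ^ 2 * sigmaThetaSq α θ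

end

end FractionalQueue

namespace FractionalQueue

/-! The estimator is a smooth function of four quantities: the death frequency, the first two
empirical moments of the centred logs of the inter-event times, and the deterministic ratio `n / (n
- d)`. The central limit theorem for its linearization, together with the delta method, therefore
gives the limit; what is left is the variance of the linearization, a polynomial of degree four in
the moments of the centred log.

Those moments are read off a transform. Integrating the Mittag-Leffler series termwise gives the
Laplace transform θ/(θ + x^α) for large x, and analyticity extends it to all x > 0
(`IsMittagLefflerLaw.laplace`). Its Mellin transform gives E S^(-s) = θ^(s/α) Γ(1 + s/α) Γ(1 - s/α)
/ Γ(1 + s) for 0 < s < α. Expanding log Γ at 1 to fourth order, where γ, π², ζ(3) and π⁴ appear, and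
comparing with the power series of the moment generating function of log S gives
`IsMittagLefflerLaw.moments_centeredLog`.

Deaths are independent of the times, so the variance of the linearization splits into a Bernoulli
part and q² σ_θ² with q = 1 - p. Since σ_θ² is itself a variance, it is nonnegative. -/

/-! ### The Mittag-Leffler series and the Laplace transform. -/

/-- Keep only the interval (R, R + 1] of Euler's integral. As R is free, Γ outgrows every geometric
sequence, which makes the Mittag-Leffler series converge. -/
lemma rpow_mul_exp_le_Gamma_add_one {R b : ℝ} (hR : 0 < R) (hb : 0 ≤ b) :
    R ^ b * Real.exp (-(R + 1)) ≤ Real.Gamma (b + 1) := by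
  rw [Real.Gamma_eq_integral (by linarith)]
  have hint : IntegrableOn (fun x : ℝ => Real.exp (-x) * x ^ (b + 1 - 1)) (Set.Ioi 0) :=
    Real.GammaIntegral_convergent (by linarith)
  have hsub : Set.Ioc R (R + 1) ⊆ Set.Ioi 0 := fun x hx => hR.trans hx.1
  calc R ^ b * Real.exp (-(R + 1))
      = ∫ _x in Set.Ioc R (R + 1), R ^ b * Real.exp (-(R + 1)) := by simp
    _ ≤ ∫ x in Set.Ioc R (R + 1), Real.exp (-x) * x ^ (b + 1 - 1) := by
        refine setIntegral_mono_on (integrableOn_const (by simp)) (hint.mono_set hsub) measurableSet_Ioc fun x hx => ?_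
        rw [add_sub_cancel_right, mul_comm]
        have := hx.2
        gcongr
        exact hx.1.le
    _ ≤ _ := setIntegral_mono_set hint
        ((ae_restrict_iff' measurableSet_Ioi).2 (ae_of_all _ fun x hx => by
          have : (0 : ℝ) < x := hx
          simp only [Pi.zero_apply]; positivity)) hsub.eventuallyLE

lemma summable_pow_div_Gamma {α : ℝ} (hα : 0 < α) (y : ℝ) :
    Summable fun j : ℕ => y ^ j / Real.Gamma (α * j + 1) := by
  -- Chosen so that R^α = 2|y| + 1, which bounds the series by a geometric one of ratio |y| / (2|y|
  -- + 1) < 1.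
  set R : ℝ := (2 * |y| + 1) ^ (1 / α)
  have hb : 0 < 2 * |y| + 1 := by positivity
  have hR : 0 < R := by positivity
  have hRα : R ^ α = 2 * |y| + 1 := by
    rw [← Real.rpow_mul hb.le, one_div_mul_cancel hα.ne', Real.rpow_one]
  have hq : |y| / (2 * |y| + 1) < 1 := by
    rw [div_lt_one hb]; linarith [abs_nonneg y]
  refine Summable.of_norm_bounded
    ((summable_geometric_of_lt_one (by positivity) hq).mul_left (Real.exp (R + 1))) fun j => ?_
  have h := rpow_mul_exp_le_Gamma_add_one hR (b := α * j) (by positivity)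
  rw [Real.rpow_mul hR.le, hRα, Real.rpow_natCast] at h
  have hG : 0 < Real.Gamma (α * j + 1) := Real.Gamma_pos_of_pos (by positivity)
  rw [norm_div, norm_pow, Real.norm_eq_abs, Real.norm_of_nonneg hG.le, div_pow,
    div_le_iff₀ hG]
  calc |y| ^ j = Real.exp (R + 1) * (|y| ^ j / (2 * |y| + 1) ^ j) *
        ((2 * |y| + 1) ^ j * Real.exp (-(R + 1))) := by
        rw [Real.exp_neg]; field_simp
    _ ≤ _ := by gcongr

/-- The `j`-th term of the power series of `1 - E_α(-θ t^α)`. -/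
noncomputable def cdfTerm (α θ : ℝ) (j : ℕ) (t : ℝ) : ℝ :=
  (-1) ^ j * θ ^ (j + 1) / Real.Gamma (α * (j + 1) + 1) * t ^ (α * (j + 1))

/-- Termwise integration is legitimate because the L¹ norms of the terms on (0, t] are the terms of
the convergent series at θ t^α without signs. -/
lemma integral_mittagLefflerDensity {α θ t : ℝ} (hα : 0 < α) (hθ : 0 < θ) (ht : 0 ≤ t) :
    ∫ u in (0 : ℝ)..t, mittagLefflerDensity α θ u = ∑' j, cdfTerm α θ j t := by
  rw [intervalIntegral.integral_of_le ht]
  set F : ℕ → ℝ → ℝ := fun j u =>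
    (-1) ^ j * θ ^ (j + 1) / Real.Gamma (α * j + α) * u ^ (α * (j + 1) - 1)
  have hexp (j : ℕ) : -1 < α * ((j : ℝ) + 1) - 1 := by
    have : 0 < α * ((j : ℝ) + 1) := by positivity
    linarith
  have hpow (j : ℕ) : ∫ u in Set.Ioc 0 t, u ^ (α * ((j : ℝ) + 1) - 1) =
      t ^ (α * ((j : ℝ) + 1)) / (α * (j + 1)) := by
    rw [← intervalIntegral.integral_of_le ht, integral_rpow (Or.inl (hexp j)), sub_add_cancel,
      Real.zero_rpow (by positivity), sub_zero]
  have hG (j : ℕ) : Real.Gamma (α * ((j : ℝ) + 1) + 1) =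
      α * (j + 1) * Real.Gamma (α * j + α) := by
    rw [Real.Gamma_add_one (by positivity), mul_add_one]
  have hGpos (j : ℕ) : 0 < Real.Gamma (α * (j : ℝ) + α) := Real.Gamma_pos_of_pos (by positivity)
  have hFint (j : ℕ) : Integrable (F j) (volume.restrict (Set.Ioc 0 t)) :=
    ((intervalIntegrable_iff_integrableOn_Ioc_of_le ht).1
      (intervalIntegral.intervalIntegrable_rpow' (hexp j))).const_mul _
  have hFval (j : ℕ) : ∫ u in Set.Ioc 0 t, F j u = cdfTerm α θ j t := by
    simp only [F, integral_const_mul, hpow, cdfTerm, hG]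
    have := (hGpos j).ne'
    field_simp
  have hFnorm (j : ℕ) : ∫ u in Set.Ioc 0 t, ‖F j u‖ =
      (θ * t ^ α) ^ (j + 1) / Real.Gamma (α * ((j + 1 : ℕ) : ℝ) + 1) := by
    have : ∀ u ∈ Set.Ioc 0 t, ‖F j u‖ =
        θ ^ (j + 1) / Real.Gamma (α * j + α) * u ^ (α * ((j : ℝ) + 1) - 1) := fun u hu => by
      simp only [F]
      rw [norm_mul, norm_div, norm_mul, norm_pow, norm_neg, norm_one, one_pow, one_mul,
        Real.norm_of_nonneg (hGpos j).le, Real.norm_of_nonneg (by positivity),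
        Real.norm_of_nonneg (Real.rpow_nonneg hu.1.le _)]
    rw [setIntegral_congr_fun measurableSet_Ioc this, integral_const_mul, hpow, mul_pow,
      ← Real.rpow_natCast (t ^ α), ← Real.rpow_mul ht, Nat.cast_add_one, hG]
    have := (hGpos j).ne'
    field_simp
  have hsum : Summable fun j => ∫ u in Set.Ioc 0 t, ‖F j u‖ := by
    simp_rw [hFnorm]
    exact (summable_nat_add_iff 1).2 (summable_pow_div_Gamma hα (θ * t ^ α))
  have h := hasSum_integral_of_summable_integral_norm hFint hsum
  simp_rw [hFval] at h
  rw [h.tsum_eq]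
  refine setIntegral_congr_fun measurableSet_Ioc fun u hu => ?_
  simp only [mittagLefflerDensity, mittagLeffler, F]
  rw [← tsum_mul_left]
  refine tsum_congr fun j => ?_
  rw [show α * ((j : ℝ) + 1) - 1 = (α - 1) + α * j by ring, Real.rpow_add hu.1,
    Real.rpow_mul hu.1.le, Real.rpow_natCast, neg_pow, mul_pow, pow_succ]
  ring

lemma IsMittagLefflerLaw.measure_Iic_zero {α θ : ℝ} {ν : Measure ℝ}
    (h : IsMittagLefflerLaw α θ ν) : ν (Set.Iic 0) = 0 := by
  have := h.1
  have h0 := h.2 0 le_rfl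
  rwa [intervalIntegral.integral_same, measureReal_eq_zero_iff] at h0

lemma IsMittagLefflerLaw.ae_pos {α θ : ℝ} {ν : Measure ℝ}
    (h : IsMittagLefflerLaw α θ ν) : ∀ᵐ t ∂ν, 0 < t := by
  rw [ae_iff]
  simpa [Set.Iic] using h.measure_Iic_zero

/-- The distribution function is prescribed on [0, ∞) and vanishes to the left of it. This is what
makes the inter-event times identically distributed. -/
lemma IsMittagLefflerLaw.eq {α θ : ℝ} {ν ν' : Measure ℝ}
    (h : IsMittagLefflerLaw α θ ν) (h' : IsMittagLefflerLaw α θ ν') : ν = ν' := by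
  have := h.1
  have := h'.1
  refine Measure.ext_of_Iic _ _ fun t => ?_
  rcases le_total 0 t with ht | ht
  · rw [← measureReal_eq_measureReal_iff, h.2 t ht, h'.2 t ht]
  · rw [measure_mono_null (Set.Iic_subset_Iic.2 ht) h.measure_Iic_zero,
      measure_mono_null (Set.Iic_subset_Iic.2 ht) h'.measure_Iic_zero]

/-- Tonelli applied to e^(-xs) = ∫_s^∞ x e^(-xt) dt. Only the distribution function of the law is
given, so the Laplace transform has to be expressed through it. -/
lemma integral_exp_neg_mul_eq {ν : Measure ℝ} [IsProbabilityMeasure ν] (hν : ∀ᵐ t ∂ν, 0 < t)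
    {x : ℝ} (hx : 0 < x) :
    ∫ t, Real.exp (-x * t) ∂ν = ∫ t in Set.Ioi 0, x * Real.exp (-x * t) * ν.real (Set.Iic t) := by
  have hinner : ∀ s : ℝ, 0 < s → ∫⁻ t in Set.Ioi 0,
      (Set.Ici s).indicator (fun t => ENNReal.ofReal (x * Real.exp (-x * t))) t =
      ENNReal.ofReal (Real.exp (-x * s)) := fun s hs => by
    rw [lintegral_indicator measurableSet_Ici, Measure.restrict_restrict measurableSet_Ici,
      Set.inter_eq_left.2 (show Set.Ici s ⊆ Set.Ioi 0 from fun t ht => hs.trans_le ht),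
      ← ofReal_integral_eq_lintegral_ofReal]
    · rw [integral_Ici_eq_integral_Ioi, integral_const_mul, integral_exp_mul_Ioi (by linarith)]
      congr 1
      field_simp
    · rw [← IntegrableOn, integrableOn_Ici_iff_integrableOn_Ioi]
      exact (integrableOn_exp_mul_Ioi (by linarith) s).const_mul x
    · exact ae_of_all _ fun t => by positivity
  rw [integral_eq_lintegral_of_nonneg_ae (ae_of_all _ fun t => by positivity) (by fun_prop),
    integral_eq_lintegral_of_nonneg_ae (ae_of_all _ fun t => by positivity)]
  swap
  · refine Measurable.aestronglyMeasurable ?_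
    have : Measurable fun t => ν.real (Set.Iic t) :=
      (monotone_iff_forall_lt.2 fun a b hab =>
        measureReal_mono (Set.Iic_subset_Iic.2 hab.le)).measurable
    fun_prop
  congr 1
  calc ∫⁻ s, ENNReal.ofReal (Real.exp (-x * s)) ∂ν
      = ∫⁻ s, (∫⁻ t in Set.Ioi 0,
          (Set.Ici s).indicator (fun t => ENNReal.ofReal (x * Real.exp (-x * t))) t) ∂ν :=
        lintegral_congr_ae (hν.mono fun s hs => (hinner s hs).symm)
    _ = ∫⁻ t in Set.Ioi 0, ∫⁻ s,
          (Set.Ici s).indicator (fun t => ENNReal.ofReal (x * Real.exp (-x * t))) t ∂ν := by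
        refine lintegral_lintegral_swap (Measurable.aemeasurable ?_)
        have : (Function.uncurry fun (s t : ℝ) => (Set.Ici s).indicator
            (fun t => ENNReal.ofReal (x * Real.exp (-x * t))) t) =
            {p : ℝ × ℝ | p.1 ≤ p.2}.indicator
              fun p => ENNReal.ofReal (x * Real.exp (-x * p.2)) := by
          ext ⟨s, t⟩; simp [Set.indicator_apply]
        rw [this]
        exact Measurable.indicator (by fun_prop) (measurableSet_le measurable_fst measurable_snd)
    _ = _ := by
        refine lintegral_congr fun t => ?_
        have : ∀ s, (Set.Ici s).indicator (fun t => ENNReal.ofReal (x * Real.exp (-x * t))) t =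
            (Set.Iic t).indicator (fun _ => ENNReal.ofReal (x * Real.exp (-x * t))) s := fun s => by
          simp [Set.indicator_apply]
        simp_rw [this]
        rw [lintegral_indicator_const measurableSet_Iic,
          ENNReal.ofReal_mul (p := x * Real.exp (-x * t)) (by positivity), ofReal_measureReal]

/-- Each power of t transforms by Euler's integral, and the series becomes geometric with ratio
-θ/x^α. Absolute convergence is what forces x^α > θ. -/
lemma IsMittagLefflerLaw.laplace_of_lt {α θ : ℝ} {ν : Measure ℝ} (hα : 0 < α) (hθ : 0 < θ)
    (h : IsMittagLefflerLaw α θ ν) {x : ℝ} (hx : 0 < x) (hxθ : θ < x ^ α) :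
    ∫ t, Real.exp (-x * t) ∂ν = θ / (θ + x ^ α) := by
  have := h.1
  rw [integral_exp_neg_mul_eq h.ae_pos hx]
  set F : ℕ → ℝ → ℝ := fun j t => x * Real.exp (-x * t) * cdfTerm α θ j t
  have hG (j : ℕ) : 0 < Real.Gamma (α * ((j : ℝ) + 1) + 1) := Real.Gamma_pos_of_pos (by positivity)
  have hxα : 0 < x ^ α := by positivity
  have hbase (j : ℕ) : ∫ t in Set.Ioi 0, t ^ (α * ((j : ℝ) + 1)) * Real.exp (-(x * t)) =
      ((x ^ α) ^ (j + 1))⁻¹ * x⁻¹ * Real.Gamma (α * (j + 1) + 1) := by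
    have := Real.integral_rpow_mul_exp_neg_mul_Ioi (a := α * ((j : ℝ) + 1) + 1) (r := x)
      (by positivity) hx
    rw [add_sub_cancel_right] at this
    rw [this, Real.rpow_add (by positivity), Real.rpow_one, one_div, Real.inv_rpow hx.le,
      Real.rpow_mul hx.le, ← Nat.cast_add_one, Real.rpow_natCast]
  have hint0 (j : ℕ) : IntegrableOn (fun t : ℝ => t ^ (α * ((j : ℝ) + 1)) * Real.exp (-(x * t)))
      (Set.Ioi 0) := by
    -- A non-integrable function has Bochner integral 0 by convention, but the integral is known to
    -- be positive.
    by_contra hcon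
    have h0 := hbase j
    rw [integral_undef hcon] at h0
    have : 0 < ((x ^ α) ^ (j + 1))⁻¹ * x⁻¹ * Real.Gamma (α * (j + 1) + 1) := by
      have := hG j; positivity
    linarith
  have hFeq (j : ℕ) : F j = fun t => (x * ((-1) ^ j * θ ^ (j + 1) /
      Real.Gamma (α * (j + 1) + 1))) * (t ^ (α * ((j : ℝ) + 1)) * Real.exp (-(x * t))) := by
    ext t; simp only [F, cdfTerm, neg_mul]; ring
  have hFint (j : ℕ) : Integrable (F j) (volume.restrict (Set.Ioi 0)) := by
    rw [hFeq]; exact (hint0 j).const_mul _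
  have hFval (j : ℕ) : ∫ t in Set.Ioi 0, F j t = θ / x ^ α * (-(θ / x ^ α)) ^ j := by
    rw [hFeq, integral_const_mul, hbase, neg_pow (θ / x ^ α), div_pow]
    have := (hG j).ne'
    rw [pow_succ (x ^ α), pow_succ θ]
    field_simp
  have hFnorm (j : ℕ) : ∫ t in Set.Ioi 0, ‖F j t‖ = θ / x ^ α * (θ / x ^ α) ^ j := by
    have : ∀ t ∈ Set.Ioi (0 : ℝ), ‖F j t‖ = (x * (θ ^ (j + 1) /
        Real.Gamma (α * (j + 1) + 1))) * (t ^ (α * ((j : ℝ) + 1)) * Real.exp (-(x * t))) :=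
      fun t ht => by
        have ht : (0 : ℝ) < t := ht
        have := hG j
        rw [hFeq, norm_mul, norm_mul, norm_div, norm_mul, norm_pow, norm_neg, norm_one, one_pow,
          one_mul, Real.norm_of_nonneg hx.le, Real.norm_of_nonneg this.le,
          Real.norm_of_nonneg (by positivity), Real.norm_of_nonneg (by positivity)]
    rw [setIntegral_congr_fun measurableSet_Ioi this, integral_const_mul, hbase, div_pow]
    have := (hG j).ne'
    rw [pow_succ (x ^ α), pow_succ θ]
    field_simp
  have hr : θ / x ^ α < 1 := (div_lt_one hxα).2 hxθ
  have hr0 : 0 ≤ θ / x ^ α := by positivity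
  have hsum := hasSum_integral_of_summable_integral_norm hFint
    (by simp_rw [hFnorm]; exact (summable_geometric_of_lt_one hr0 hr).mul_left _)
  simp_rw [hFval] at hsum
  have hgeom := (hasSum_geometric_of_abs_lt_one (r := -(θ / x ^ α))
    (by rwa [abs_neg, abs_of_nonneg hr0])).mul_left (θ / x ^ α)
  have hval := hsum.unique hgeom
  rw [show θ / (θ + x ^ α) = θ / x ^ α * (1 - -(θ / x ^ α))⁻¹ by
    rw [sub_neg_eq_add]; field_simp; ring, ← hval]
  refine setIntegral_congr_fun measurableSet_Ioi fun t ht => ?_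
  have ht : (0 : ℝ) < t := ht
  simp only [F]
  rw [tsum_mul_left, h.2 t ht.le, integral_mittagLefflerDensity hα hθ ht.le]

lemma integrable_exp_neg_mul {ν : Measure ℝ} [IsProbabilityMeasure ν] (hν : ∀ᵐ t ∂ν, 0 < t)
    {x : ℝ} (hx : 0 ≤ x) : Integrable (fun t => Real.exp (-x * t)) ν := by
  refine Integrable.of_bound (by fun_prop) 1 (hν.mono fun t ht => ?_)
  rw [Real.norm_of_nonneg (by positivity), Real.exp_le_one_iff]
  nlinarith

/-- Both sides are real-analytic on (0, ∞) and agree for large x, so the identity theorem removes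
the restriction x^α > θ. -/
lemma IsMittagLefflerLaw.laplace {α θ : ℝ} {ν : Measure ℝ} (hα : 0 < α) (hθ : 0 < θ)
    (h : IsMittagLefflerLaw α θ ν) {x : ℝ} (hx : 0 < x) :
    ∫ t, Real.exp (-x * t) ∂ν = θ / (θ + x ^ α) := by
  have := h.1
  have hsub : Set.Iio (0 : ℝ) ⊆ integrableExpSet id ν := fun y hy => by
    have := integrable_exp_neg_mul h.ae_pos (x := -y) (by simpa using (Set.mem_Iio.1 hy).le)
    simpa [integrableExpSet] using this
  have hint := interior_maximal hsub isOpen_Iio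
  have hmgf : AnalyticOnNhd ℝ (fun x => mgf id ν (-x)) (Set.Ioi 0) := fun x hx =>
    AnalyticAt.fun_comp (analyticAt_mgf (hint (by simpa using hx))) (by fun_prop)
  have hrhs : AnalyticOnNhd ℝ (fun x : ℝ => θ / (θ + x ^ α)) (Set.Ioi 0) := fun x hx => by
    have hx : (0 : ℝ) < x := hx
    have hp : AnalyticAt ℝ (fun x : ℝ => x ^ α) x :=
      (((analyticAt_log hx).mul analyticAt_const).rexp).congr
        ((lt_mem_nhds hx).mono fun y hy => (Real.rpow_def_of_pos hy α).symm)
    exact analyticAt_const.div (analyticAt_const.add hp) (by positivity)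
  -- At this base point x^α = θ + 1 > θ, so a whole neighbourhood lies in the range of the series.
  have hev : (fun x => mgf id ν (-x)) =ᶠ[𝓝 ((θ + 1) ^ (1 / α))]
      fun x : ℝ => θ / (θ + x ^ α) := by
    have hpos : 0 < (θ + 1) ^ (1 / α) := by positivity
    have hlt : θ < ((θ + 1) ^ (1 / α)) ^ α := by
      rw [← Real.rpow_mul (by positivity), one_div_mul_cancel hα.ne', Real.rpow_one]; linarith
    filter_upwards [lt_mem_nhds hpos,
      (Real.continuousAt_rpow_const _ α (Or.inl hpos.ne')).eventually (lt_mem_nhds hlt)]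
      with y hy hy'
    exact h.laplace_of_lt hα hθ hy hy'
  have key := hmgf.eqOn_of_preconnected_of_eventuallyEq hrhs isPreconnected_Ioi
    (show (θ + 1) ^ (1 / α) ∈ Set.Ioi (0 : ℝ) from by
      have : 0 < (θ + 1) ^ (1 / α) := by positivity
      exact this) hev
  exact key hx

/-! ### Fractional moments, and exponential moments of the logarithm. -/

section

lemma lintegral_ofReal_eq_of_integral_pos {β : Type*} [MeasurableSpace β] {m : Measure β}
    {f : β → ℝ} (hf : 0 ≤ᵐ[m] f) (h : 0 < ∫ x, f x ∂m) :
    ∫⁻ x, ENNReal.ofReal (f x) ∂m = ENNReal.ofReal (∫ x, f x ∂m) := by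
  refine (ofReal_integral_eq_lintegral_ofReal ?_ hf).symm
  by_contra hcon
  rw [integral_undef hcon] at h
  exact h.false

lemma lintegral_rpow_mul_exp_neg_mul_rpow {p q b : ℝ} (hp : 0 < p) (hq : -1 < q) (hb : 0 < b) :
    ∫⁻ x in Set.Ioi (0 : ℝ), ENNReal.ofReal (x ^ q * Real.exp (-b * x ^ p)) =
      ENNReal.ofReal (b ^ (-(q + 1) / p) * (1 / p) * Real.Gamma ((q + 1) / p)) := by
  rw [← integral_rpow_mul_exp_neg_mul_rpow hp hq hb]
  refine lintegral_ofReal_eq_of_integral_pos ?_ ?_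
  · refine (ae_restrict_iff' measurableSet_Ioi).2 (ae_of_all _ fun x hx => ?_)
    have hx : (0 : ℝ) < x := hx
    simp only [Pi.zero_apply]; positivity
  · rw [integral_rpow_mul_exp_neg_mul_rpow hp hq hb]
    have : 0 < Real.Gamma ((q + 1) / p) := Real.Gamma_pos_of_pos (div_pos (by linarith) hp)
    positivity

lemma lintegral_rpow_mul_exp_neg_mul {q b : ℝ} (hq : -1 < q) (hb : 0 < b) :
    ∫⁻ x in Set.Ioi (0 : ℝ), ENNReal.ofReal (x ^ q * Real.exp (-b * x)) =
      ENNReal.ofReal (b ^ (-(q + 1)) * Real.Gamma (q + 1)) := by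
  simpa using lintegral_rpow_mul_exp_neg_mul_rpow one_pos hq hb

/-- Write θ/(θ + x^α) as ∫ θ e^(-θy) e^(-y x^α) dy and integrate in x first: two Gamma integrals
remain. Working with `∫⁻` lets Tonelli apply without any integrability check. -/
lemma lintegral_rpow_mul_div_add_rpow {α θ s : ℝ} (hα : 0 < α) (hθ : 0 < θ) (hs : 0 < s)
    (hsα : s < α) :
    ∫⁻ x in Set.Ioi (0 : ℝ), ENNReal.ofReal (x ^ (s - 1) * (θ / (θ + x ^ α))) =
      ENNReal.ofReal (θ ^ (s / α) * Real.Gamma (s / α) * Real.Gamma (1 - s / α) / α) := by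
  have hu : s / α < 1 := (div_lt_one hα).2 hsα
  have hu0 : 0 < s / α := by positivity
  have hGu := Real.Gamma_pos_of_pos hu0
  calc ∫⁻ x in Set.Ioi (0 : ℝ), ENNReal.ofReal (x ^ (s - 1) * (θ / (θ + x ^ α)))
      = ∫⁻ x in Set.Ioi (0 : ℝ), ∫⁻ y in Set.Ioi (0 : ℝ),
          ENNReal.ofReal (θ * Real.exp (-θ * y)) *
            ENNReal.ofReal (x ^ (s - 1) * Real.exp (-y * x ^ α)) := by
        refine setLIntegral_congr_fun measurableSet_Ioi fun x hx => ?_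
        have hx : (0 : ℝ) < x := hx
        have h0 := lintegral_rpow_mul_exp_neg_mul (q := 0) (b := θ + x ^ α) (by norm_num)
          (by positivity)
        simp only [Real.rpow_zero, one_mul, zero_add, Real.Gamma_one, mul_one,
          Real.rpow_neg_one] at h0
        have hsplit : ∀ y : ℝ, ENNReal.ofReal (θ * Real.exp (-θ * y)) *
            ENNReal.ofReal (x ^ (s - 1) * Real.exp (-y * x ^ α)) =
            ENNReal.ofReal (x ^ (s - 1) * θ) * ENNReal.ofReal (Real.exp (-(θ + x ^ α) * y)) :=
          fun y => by
            rw [← ENNReal.ofReal_mul (by positivity), ← ENNReal.ofReal_mul (by positivity)]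
            congr 1
            rw [show -(θ + x ^ α) * y = -θ * y + -y * x ^ α by ring, Real.exp_add]
            ring
        simp_rw [hsplit]
        rw [lintegral_const_mul' _ _ (by simp), h0, ← ENNReal.ofReal_mul (by positivity)]
        congr 1
        rw [div_eq_mul_inv]; ring
    _ = ∫⁻ y in Set.Ioi (0 : ℝ), ∫⁻ x in Set.Ioi (0 : ℝ),
          ENNReal.ofReal (θ * Real.exp (-θ * y)) *
            ENNReal.ofReal (x ^ (s - 1) * Real.exp (-y * x ^ α)) := by
        refine lintegral_lintegral_swap (Measurable.aemeasurable ?_)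
        simp only [Function.uncurry_def]
        fun_prop
    _ = ∫⁻ y in Set.Ioi (0 : ℝ), ENNReal.ofReal (θ * (1 / α) * Real.Gamma (s / α)) *
          ENNReal.ofReal (y ^ (-(s / α)) * Real.exp (-θ * y)) := by
        refine setLIntegral_congr_fun measurableSet_Ioi fun y hy => ?_
        have hy : (0 : ℝ) < y := hy
        rw [lintegral_const_mul' _ _ (by simp),
          lintegral_rpow_mul_exp_neg_mul_rpow hα (by linarith) hy, sub_add_cancel,
          ← ENNReal.ofReal_mul (by positivity), ← ENNReal.ofReal_mul (by positivity), neg_div]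
        congr 1
        ring
    _ = _ := by
        rw [lintegral_const_mul' _ _ (by simp), lintegral_rpow_mul_exp_neg_mul (by linarith) hθ,
          ← ENNReal.ofReal_mul (by positivity)]
        congr 1
        rw [show -(-(s / α) + 1) = s / α - 1 by ring, Real.rpow_sub_one hθ.ne',
          show -(s / α) + 1 = 1 - s / α by ring]
        field_simp

variable {α θ s : ℝ} {ν : Measure ℝ}

/-- Since Γ(s) t^(-s) = ∫ x^(s-1) e^(-tx) dx, Tonelli turns the negative moment into the Mellin
transform of the Laplace transform. -/
lemma IsMittagLefflerLaw.lintegral_rpow_neg (hα : 0 < α) (hθ : 0 < θ)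
    (h : IsMittagLefflerLaw α θ ν) (hs : 0 < s) (hsα : s < α) :
    ∫⁻ t, ENNReal.ofReal (t ^ (-s)) ∂ν = ENNReal.ofReal
      (θ ^ (s / α) * Real.Gamma (1 + s / α) * Real.Gamma (1 - s / α) / Real.Gamma (1 + s)) := by
  have := h.1
  have hGs := Real.Gamma_pos_of_pos hs
  have key : ENNReal.ofReal (Real.Gamma s) * ∫⁻ t, ENNReal.ofReal (t ^ (-s)) ∂ν =
      ENNReal.ofReal (θ ^ (s / α) * Real.Gamma (s / α) * Real.Gamma (1 - s / α) / α) := by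
    rw [← lintegral_rpow_mul_div_add_rpow hα hθ hs hsα]
    calc ENNReal.ofReal (Real.Gamma s) * ∫⁻ t, ENNReal.ofReal (t ^ (-s)) ∂ν
        = ∫⁻ t, (∫⁻ x in Set.Ioi (0 : ℝ), ENNReal.ofReal (x ^ (s - 1) * Real.exp (-t * x))) ∂ν := by
          rw [← lintegral_const_mul' _ _ (by simp)]
          refine lintegral_congr_ae (h.ae_pos.mono fun t ht => ?_)
          simp only
          rw [lintegral_rpow_mul_exp_neg_mul (by linarith) ht, sub_add_cancel, mul_comm,
            ENNReal.ofReal_mul (by positivity)]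
      _ = ∫⁻ x in Set.Ioi (0 : ℝ), (∫⁻ t, ENNReal.ofReal (x ^ (s - 1) * Real.exp (-t * x)) ∂ν) := by
          refine lintegral_lintegral_swap (Measurable.aemeasurable ?_)
          simp only [Function.uncurry_def]
          fun_prop
      _ = _ := by
          refine setLIntegral_congr_fun measurableSet_Ioi fun x hx => ?_
          have hx : (0 : ℝ) < x := hx
          have hcomm : ∀ t : ℝ, -t * x = -x * t := fun t => by ring
          simp only [hcomm]
          rw [← ofReal_integral_eq_lintegral_ofReal
            ((integrable_exp_neg_mul h.ae_pos hx.le).const_mul _)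
            (ae_of_all _ fun t => by positivity), integral_const_mul, h.laplace hα hθ hx]
  have hu : s / α < 1 := (div_lt_one hα).2 hsα
  have hu0 : 0 < s / α := by positivity
  rw [← ENNReal.eq_div_iff (by simpa using hGs) (by simp)] at key
  rw [key, ← ENNReal.ofReal_div_of_pos hGs, add_comm 1, Real.Gamma_add_one hu0.ne', add_comm 1,
    Real.Gamma_add_one hs.ne']
  congr 1
  field_simp

/-- Markov's inequality for 1 - e^(-u/t), whose mean is at most t^(-α)/θ by the Laplace transform.
-/
lemma IsMittagLefflerLaw.measure_Ioi_le (hα : 0 < α) (hθ : 0 < θ)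
    (h : IsMittagLefflerLaw α θ ν) {t : ℝ} (ht : 0 < t) :
    ν.real (Set.Ioi t) ≤ ((1 - Real.exp (-1)) * θ)⁻¹ * t ^ (-α) := by
  have := h.1
  have he : 0 < 1 - Real.exp (-1) := by
    rw [sub_pos, Real.exp_lt_one_iff]; norm_num
  have hint := integrable_exp_neg_mul h.ae_pos (x := t⁻¹) (by positivity)
  have hm := mul_meas_ge_le_integral_of_nonneg (μ := ν) (f := fun u => 1 - Real.exp (-t⁻¹ * u))
    (h.ae_pos.mono fun u hu => by
      simp only [Pi.zero_apply, sub_nonneg, Real.exp_le_one_iff]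
      have : 0 < t⁻¹ * u := by positivity
      linarith) ((integrable_const 1).sub hint) (1 - Real.exp (-1))
  rw [integral_sub (integrable_const 1) hint, h.laplace hα hθ (inv_pos.2 ht)] at hm
  have hsub : ν.real (Set.Ioi t) ≤
      ν.real {u | 1 - Real.exp (-1) ≤ 1 - Real.exp (-t⁻¹ * u)} := by
    refine measureReal_mono fun u hu => ?_
    have hu : t < u := hu
    simp only [Set.mem_ofPred_eq, sub_le_sub_iff_left, Real.exp_le_exp, neg_mul, neg_le_neg_iff]
    rw [inv_mul_eq_div, one_le_div ht]
    exact hu.le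
  have hb : (∫ _u, (1 : ℝ) ∂ν) - θ / (θ + t⁻¹ ^ α) ≤ t ^ (-α) / θ := by
    rw [integral_const, probReal_univ, one_smul, Real.inv_rpow ht.le, ← Real.rpow_neg ht.le]
    have : 0 < t ^ (-α) := by positivity
    rw [one_sub_div (by positivity), add_sub_cancel_left]
    gcongr
    linarith
  rw [mul_inv, mul_assoc, ← div_le_iff₀' (by positivity), div_inv_eq_mul, mul_comm]
  calc _ ≤ _ := mul_le_mul_of_nonneg_left hsub he.le
    _ ≤ _ := hm
    _ ≤ _ := hb
    _ = _ := by rw [div_eq_inv_mul]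

/-- Layer-cake formula split at 1: below, t^(s-1) is integrable; above, the tail bound leaves
t^(s-1-α). Finiteness is enough here, since only the negative moments are needed exactly. -/
lemma IsMittagLefflerLaw.lintegral_rpow_lt_top (hα : 0 < α) (hθ : 0 < θ)
    (h : IsMittagLefflerLaw α θ ν) (hs : 0 < s) (hsα : s < α) :
    ∫⁻ t, ENNReal.ofReal (t ^ s) ∂ν < ∞ := by
  have := h.1
  have he : 0 < 1 - Real.exp (-1) := by
    rw [sub_pos, Real.exp_lt_one_iff]; norm_num
  rw [lintegral_rpow_eq_lintegral_meas_lt_mul ν (h.ae_pos.mono fun t ht => ht.le)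
    aemeasurable_id hs]
  refine ENNReal.mul_lt_top (by simp) ?_
  rw [← Set.Ioc_union_Ioi_eq_Ioi zero_le_one,
    lintegral_union measurableSet_Ioi (Set.Ioc_disjoint_Ioi le_rfl)]
  refine ENNReal.add_lt_top.2 ⟨?_, ?_⟩
  · refine (setLIntegral_mono' measurableSet_Ioc fun t ht =>
      mul_le_of_le_one_left zero_le prob_le_one).trans_lt ?_
    exact (((intervalIntegrable_iff_integrableOn_Ioc_of_le zero_le_one).1
      (intervalIntegral.intervalIntegrable_rpow' (r := s - 1) (by linarith))).lintegral_lt_top)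
  · refine (setLIntegral_mono' (g := fun t => ENNReal.ofReal
      (((1 - Real.exp (-1)) * θ)⁻¹ * t ^ (s - 1 - α))) measurableSet_Ioi fun t ht => ?_).trans_lt ?_
    · have ht : 0 < t := one_pos.trans ht
      have hm := h.measure_Ioi_le hα hθ ht
      rw [← ofReal_measureReal, ← ENNReal.ofReal_mul (by positivity)]
      refine ENNReal.ofReal_le_ofReal ?_
      rw [sub_eq_add_neg _ α, add_comm, Real.rpow_add ht, ← mul_assoc]
      gcongr
      exact hm
    · exact ((integrableOn_Ioi_rpow_of_lt (by linarith) one_pos).const_mul _).lintegral_lt_top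

lemma exp_mul_log_eq {t : ℝ} (ht : 0 < t) (r : ℝ) : Real.exp (r * Real.log t) = t ^ r := by
  rw [Real.rpow_def_of_pos ht, mul_comm]

lemma IsMittagLefflerLaw.integrableExpSet_log (hα : 0 < α) (hθ : 0 < θ)
    (h : IsMittagLefflerLaw α θ ν) : Set.Ioo (-α) α ⊆ integrableExpSet Real.log ν := by
  have := h.1
  intro r hr
  have hfin : ∫⁻ t, ENNReal.ofReal (t ^ r) ∂ν < ∞ := by
    rcases lt_trichotomy r 0 with h0 | h0 | h0
    · have := h.lintegral_rpow_neg hα hθ (s := -r) (by linarith) (by linarith [hr.1])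
      rw [neg_neg] at this
      rw [this]
      exact ENNReal.ofReal_lt_top
    · simp [h0]
    · exact h.lintegral_rpow_lt_top hα hθ h0 hr.2
  refine ⟨by fun_prop, ?_⟩
  rw [hasFiniteIntegral_iff_ofReal (ae_of_all _ fun t => by positivity)]
  refine lt_of_eq_of_lt (lintegral_congr_ae (h.ae_pos.mono fun t ht => ?_)) hfin
  simp only
  rw [exp_mul_log_eq ht]

lemma IsMittagLefflerLaw.mgf_log_neg (hα : 0 < α) (hθ : 0 < θ)
    (h : IsMittagLefflerLaw α θ ν) (hs : 0 < s) (hsα : s < α) :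
    mgf Real.log ν (-s) =
      θ ^ (s / α) * Real.Gamma (1 + s / α) * Real.Gamma (1 - s / α) / Real.Gamma (1 + s) := by
  have hu : s / α < 1 := (div_lt_one hα).2 hsα
  rw [mgf, integral_eq_lintegral_of_nonneg_ae (ae_of_all _ fun t => by positivity) (by fun_prop),
    lintegral_congr_ae (h.ae_pos.mono fun t ht => by rw [exp_mul_log_eq ht]),
    h.lintegral_rpow_neg hα hθ hs hsα, ENNReal.toReal_ofReal]
  have := Real.Gamma_pos_of_pos (show 0 < 1 + s / α by positivity)
  have := Real.Gamma_pos_of_pos (show 0 < 1 - s / α by linarith)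
  have := Real.Gamma_pos_of_pos (show 0 < 1 + s by positivity)
  positivity

end

/-! ### Fourth-order expansion of log Γ at 1 and comparison of coefficients. -/

section

lemma abs_log_one_add_sub_le {u : ℝ} (hu : |u| ≤ 1 / 2) :
    |Real.log (1 + u) - (u - u ^ 2 / 2 + u ^ 3 / 3 - u ^ 4 / 4)| ≤ 2 * |u| ^ 5 := by
  have h := Real.abs_log_sub_add_sum_range_le (x := -u) (by rw [abs_neg]; linarith) 4
  simp only [Finset.sum_range_succ, Finset.sum_range_zero, abs_neg, sub_neg_eq_add] at h
  norm_num at h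
  refine le_trans (le_of_eq ?_) (h.trans ?_)
  · congr 1; ring
  · rw [div_le_iff₀ (by linarith)]
    nlinarith [pow_nonneg (abs_nonneg u) 5]

lemma hasSum_one_div_succ_pow_three :
    HasSum (fun k : ℕ => 1 / ((k : ℝ) + 1) ^ 3) (riemannZeta 3).re := by
  have hs : Summable fun n : ℕ => 1 / (n : ℝ) ^ 3 :=
    Real.summable_one_div_nat_pow.2 (by norm_num)
  have hz : (riemannZeta 3).re = ∑' n : ℕ, 1 / (n : ℝ) ^ 3 := by
    have := zeta_nat_eq_tsum_of_gt_one (k := 3) (by norm_num)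
    rw [show ((3 : ℕ) : ℂ) = 3 by norm_num] at this
    rw [this, ← Complex.ofReal_re (∑' n : ℕ, 1 / (n : ℝ) ^ 3)]
    push_cast
    rfl
  have := (hasSum_nat_add_iff' 1).2 hs.hasSum
  simpa [hz] using this

lemma hasSum_one_div_succ_pow_two :
    HasSum (fun k : ℕ => 1 / ((k : ℝ) + 1) ^ 2) (Real.pi ^ 2 / 6) := by
  simpa using (hasSum_nat_add_iff' 1).2 hasSum_zeta_two

lemma hasSum_one_div_succ_pow_four :
    HasSum (fun k : ℕ => 1 / ((k : ℝ) + 1) ^ 4) (Real.pi ^ 4 / 90) := by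
  simpa using (hasSum_nat_add_iff' 1).2 hasSum_zeta_four

/-- Regroups the Gauss product in Weierstrass form: a term tending to -γ s, a vanishing correction,
and a convergent sum of log(1 + s/k) - s/k. -/
lemma logGammaSeq_one_add {s : ℝ} (hs : -1 < s) (n : ℕ) :
    Real.BohrMollerup.logGammaSeq (1 + s) n =
      -s * (harmonic (n + 1) - Real.log ((n + 1 : ℕ) : ℝ)) -
        (1 + s) * (Real.log ((n : ℝ) + 1) - Real.log n) -
        ∑ k ∈ Finset.range (n + 1), (Real.log (1 + s / (k + 1)) - s / (k + 1)) := by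
  have h1 : ∑ m ∈ Finset.range (n + 1), Real.log (1 + s + m) =
      ∑ k ∈ Finset.range (n + 1), Real.log (1 + s / (k + 1)) + Real.log (n + 1).factorial := by
    rw [← Finset.prod_range_add_one_eq_factorial, Nat.cast_prod, Real.log_prod (fun i _ => by positivity),
      ← Finset.sum_add_distrib]
    refine Finset.sum_congr rfl fun k _ => ?_
    have hk : (0 : ℝ) < k + 1 := by positivity
    have : 0 < 1 + s / ((k : ℝ) + 1) := by
      rw [← sub_neg_eq_add, sub_pos, ← neg_div, div_lt_one hk]
      have : (0 : ℝ) ≤ k := by positivity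
      linarith
    push_cast
    rw [← Real.log_mul this.ne' hk.ne']
    congr 1
    field_simp
    ring
  have h2 : ((harmonic (n + 1) : ℚ) : ℝ) = ∑ k ∈ Finset.range (n + 1), 1 / ((k : ℝ) + 1) := by
    simp [harmonic]
  have h3 : ∑ k ∈ Finset.range (n + 1), s / ((k : ℝ) + 1) = s * (harmonic (n + 1) : ℚ) := by
    rw [h2, Finset.mul_sum]
    exact Finset.sum_congr rfl fun k _ => by ring
  have h4 : Real.log (n + 1).factorial = Real.log n.factorial + Real.log ((n : ℝ) + 1) := by
    rw [Nat.factorial_succ, Nat.cast_mul, Real.log_mul (by positivity) (by positivity), add_comm]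
    push_cast
    rfl
  rw [Real.BohrMollerup.logGammaSeq, h1, Finset.sum_sub_distrib, h3, h4]
  push_cast
  ring

/-- The fourth-order Taylor polynomial of `log Γ` at `1`. -/
noncomputable def logGammaTaylor (s : ℝ) : ℝ :=
  -Real.eulerMascheroniConstant * s + Real.pi ^ 2 / 12 * s ^ 2 - (riemannZeta 3).re / 3 * s ^ 3 +
    Real.pi ^ 4 / 360 * s ^ 4

lemma abs_log_Gamma_one_add_sub_le {s : ℝ} (hs : |s| ≤ 1 / 2) :
    |Real.log (Real.Gamma (1 + s)) - logGammaTaylor s| ≤ Real.pi ^ 2 / 3 * |s| ^ 5 := by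
  have hs' := abs_le.1 hs
  -- The n-th approximant with every log(1 + s/k) replaced by its quartic Taylor polynomial. The
  -- error is bounded uniformly in n by 2|s|⁵ ζ(2), hence the constant π²/3.
  set q : ℕ → ℝ → ℝ := fun n s => -s * (harmonic (n + 1) - Real.log ((n + 1 : ℕ) : ℝ)) -
    (1 + s) * (Real.log ((n : ℝ) + 1) - Real.log n) +
    s ^ 2 / 2 * ∑ k ∈ Finset.range (n + 1), 1 / ((k : ℝ) + 1) ^ 2 -
    s ^ 3 / 3 * ∑ k ∈ Finset.range (n + 1), 1 / ((k : ℝ) + 1) ^ 3 +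
    s ^ 4 / 4 * ∑ k ∈ Finset.range (n + 1), 1 / ((k : ℝ) + 1) ^ 4 with hq
  have hbound (n : ℕ) : |Real.BohrMollerup.logGammaSeq (1 + s) n - q n s| ≤
      Real.pi ^ 2 / 3 * |s| ^ 5 := by
    have heq : Real.BohrMollerup.logGammaSeq (1 + s) n - q n s =
        -∑ k ∈ Finset.range (n + 1), (Real.log (1 + s / (k + 1)) - (s / (k + 1) -
          (s / (k + 1)) ^ 2 / 2 + (s / (k + 1)) ^ 3 / 3 - (s / (k + 1)) ^ 4 / 4)) := by
      rw [logGammaSeq_one_add (by linarith), hq]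
      simp only [Finset.mul_sum, Finset.sum_sub_distrib, Finset.sum_add_distrib]
      have e2 : ∀ k : ℕ, s ^ 2 / 2 * (1 / ((k : ℝ) + 1) ^ 2) = (s / (k + 1)) ^ 2 / 2 :=
        fun k => by rw [div_pow]; ring
      have e3 : ∀ k : ℕ, s ^ 3 / 3 * (1 / ((k : ℝ) + 1) ^ 3) = (s / (k + 1)) ^ 3 / 3 :=
        fun k => by rw [div_pow]; ring
      have e4 : ∀ k : ℕ, s ^ 4 / 4 * (1 / ((k : ℝ) + 1) ^ 4) = (s / (k + 1)) ^ 4 / 4 :=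
        fun k => by rw [div_pow]; ring
      simp only [e2, e3, e4]
      ring
    rw [heq, abs_neg]
    calc _ ≤ ∑ k ∈ Finset.range (n + 1), 2 * |s| ^ 5 * (1 / ((k : ℝ) + 1) ^ 2) := by
          refine (Finset.abs_sum_le_sum_abs _ _).trans (Finset.sum_le_sum fun k _ => ?_)
          have hk : (1 : ℝ) ≤ k + 1 := by
            have : (0 : ℝ) ≤ k := by positivity
            linarith
          have habs : |s / ((k : ℝ) + 1)| = |s| / (k + 1) := by
            rw [abs_div, abs_of_pos (by linarith : (0 : ℝ) < k + 1)]
          refine (abs_log_one_add_sub_le ?_).trans ?_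
          · rw [habs]
            exact (div_le_self (abs_nonneg s) hk).trans hs
          · rw [habs, div_pow, mul_assoc, div_eq_mul_one_div (|s| ^ 5)]
            gcongr
            norm_num
      _ ≤ 2 * |s| ^ 5 * (Real.pi ^ 2 / 6) := by
          rw [← Finset.mul_sum]
          gcongr
          exact sum_le_hasSum _ (fun k _ => by positivity) hasSum_one_div_succ_pow_two
      _ = _ := by ring
  have hlim : Tendsto (fun n => Real.BohrMollerup.logGammaSeq (1 + s) n - q n s) atTop
      (𝓝 (Real.log (Real.Gamma (1 + s)) - logGammaTaylor s)) := by
    refine (Real.BohrMollerup.tendsto_log_gamma (by linarith)).sub ?_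
    have hγ := Real.tendsto_harmonic_sub_log.comp (tendsto_add_atTop_nat 1)
    have hδ : Tendsto (fun n : ℕ => Real.log ((n : ℝ) + 1) - Real.log n) atTop (𝓝 0) :=
      Real.tendsto_log_nat_add_one_sub_log
    have h2 := hasSum_one_div_succ_pow_two.tendsto_sum_nat.comp (tendsto_add_atTop_nat 1)
    have h3 := hasSum_one_div_succ_pow_three.tendsto_sum_nat.comp (tendsto_add_atTop_nat 1)
    have h4 := hasSum_one_div_succ_pow_four.tendsto_sum_nat.comp (tendsto_add_atTop_nat 1)
    have := ((((hγ.const_mul (-s)).sub (hδ.const_mul (1 + s))).add (h2.const_mul (s ^ 2 / 2))).sub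
      (h3.const_mul (s ^ 3 / 3))).add (h4.const_mul (s ^ 4 / 4))
    rw [show logGammaTaylor s = -s * Real.eulerMascheroniConstant - (1 + s) * 0 +
      s ^ 2 / 2 * (Real.pi ^ 2 / 6) - s ^ 3 / 3 * (riemannZeta 3).re +
      s ^ 4 / 4 * (Real.pi ^ 4 / 90) by rw [logGammaTaylor]; ring]
    exact this
  exact le_of_tendsto hlim.abs (Eventually.of_forall hbound)

lemma isBigO_log_Gamma_one_add_sub :
    (fun s => Real.log (Real.Gamma (1 + s)) - logGammaTaylor s) =O[𝓝 0] fun s => s ^ 5 := by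
  refine Asymptotics.IsBigO.of_bound (Real.pi ^ 2 / 3) ?_
  have : ∀ᶠ s : ℝ in 𝓝 0, |s| < 1 / 2 := by
    have := (continuous_abs.tendsto (0 : ℝ))
    rw [abs_zero] at this
    exact this.eventually (gt_mem_nhds (by norm_num))
  filter_upwards [this] with s hs
  rw [Real.norm_eq_abs, norm_pow, Real.norm_eq_abs]
  exact abs_log_Gamma_one_add_sub_le hs.le

/-- Without a linear term g = O(s²), so g³ = O(s⁶) and g²/2 contributes only c₂²/2 · s⁴ up to O(s⁵).
-/
lemma isBigO_exp_sub_of_isBigO {l : Filter ℝ} (hl : l ≤ 𝓝 0) {g : ℝ → ℝ} {c₂ c₃ c₄ : ℝ}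
    (hg : (fun s => g s - (c₂ * s ^ 2 + c₃ * s ^ 3 + c₄ * s ^ 4)) =O[l] fun s => s ^ 5) :
    (fun s => Real.exp (g s) - (1 + c₂ * s ^ 2 + c₃ * s ^ 3 + (c₄ + c₂ ^ 2 / 2) * s ^ 4))
      =O[l] fun s => s ^ 5 := by
  have hpow {m n : ℕ} (h : m < n) : (fun s : ℝ => s ^ n) =O[l] fun s => s ^ m :=
    ((Asymptotics.isLittleO_pow_pow h).isBigO).mono hl
  have h3 : (fun s => g s - c₂ * s ^ 2) =O[l] fun s => s ^ 3 := by
    have := ((hg.trans (hpow (m := 3) (by norm_num))).add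
      ((Asymptotics.isBigO_refl (fun s : ℝ => s ^ 3) l).const_mul_left c₃)).add
      ((hpow (m := 3) (n := 4) (by norm_num)).const_mul_left c₄)
    exact this.congr_left fun s => by ring
  have h2c : (fun s => c₂ * s ^ 2) =O[l] fun s => s ^ 2 :=
    (Asymptotics.isBigO_refl (fun s : ℝ => s ^ 2) l).const_mul_left c₂
  have h2 : g =O[l] fun s => s ^ 2 :=
    ((h3.trans (hpow (m := 2) (by norm_num))).add h2c).congr_left fun s => by ring
  have hg0 : Tendsto g l (𝓝 0) := by
    refine h2.trans_tendsto ?_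
    have : Tendsto (fun s : ℝ => s ^ 2) (𝓝 0) (𝓝 (0 ^ 2)) := (continuous_pow 2).tendsto 0
    rw [zero_pow two_ne_zero] at this
    exact this.mono_left hl
  have hexp : (fun s => Real.exp (g s) - ∑ i ∈ Finset.range 3, g s ^ i / i.factorial)
      =O[l] fun s => s ^ 5 := by
    have h6 : (fun s => g s ^ 3) =O[l] fun s => s ^ 6 :=
      (h2.pow 3).congr_right fun s => by ring
    exact (((Real.exp_sub_sum_range_isBigO_pow 3).comp_tendsto hg0).trans h6).trans
      (hpow (by norm_num))
  have hsq : (fun s => (g s - c₂ * s ^ 2) * (g s + c₂ * s ^ 2)) =O[l] fun s => s ^ 5 :=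
    (h3.mul (h2.add h2c)).congr_right fun s => by ring
  refine ((hexp.add hg).add (hsq.const_mul_left (1 / 2))).congr_left fun s => ?_
  simp only [Finset.sum_range_succ, Finset.sum_range_zero]
  norm_num
  ring

/-- Let s → 0 to kill the constant term, divide by s, and induct. A one-sided limit is used because
the moment formula is available for s > 0 only. -/
lemma coeff_eq_zero_of_isBigO_pow (n : ℕ) (d : ℕ → ℝ)
    (h : (fun s : ℝ => ∑ k ∈ Finset.range n, d k * s ^ k) =O[𝓝[>] 0] fun s => s ^ n) :
    ∀ k < n, d k = 0 := by
  induction n generalizing d with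
  | zero => simp
  | succ n ih =>
    have hcont : Tendsto (fun s : ℝ => ∑ k ∈ Finset.range (n + 1), d k * s ^ k) (𝓝[>] 0)
        (𝓝 (∑ k ∈ Finset.range (n + 1), d k * (0 : ℝ) ^ k)) :=
      ((by fun_prop : Continuous fun s : ℝ =>
        ∑ k ∈ Finset.range (n + 1), d k * s ^ k).tendsto 0).mono_left nhdsWithin_le_nhds
    have hz : Tendsto (fun s : ℝ => s ^ (n + 1)) (𝓝[>] 0) (𝓝 0) := by
      have := ((continuous_pow (n + 1)).tendsto (0 : ℝ)).mono_left
        (nhdsWithin_le_nhds (s := Set.Ioi 0))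
      rwa [zero_pow n.succ_ne_zero] at this
    have h0 : d 0 = 0 := by
      have := tendsto_nhds_unique hcont (h.trans_tendsto hz)
      simpa [Finset.sum_range_succ'] using this
    have hshift : (fun s : ℝ => ∑ k ∈ Finset.range n, d (k + 1) * s ^ k) =O[𝓝[>] 0]
        fun s => s ^ n := by
      have hmul := (Asymptotics.isBigO_refl (fun s : ℝ => s⁻¹) (𝓝[>] 0)).mul h
      refine hmul.congr' ?_ ?_
      · filter_upwards [self_mem_nhdsWithin] with s (hs : 0 < s)
        rw [Finset.sum_range_succ', h0, zero_mul, add_zero, Finset.mul_sum]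
        refine Finset.sum_congr rfl fun k _ => ?_
        rw [pow_succ]; field_simp
      · filter_upwards [self_mem_nhdsWithin] with s (hs : 0 < s)
        rw [pow_succ]; field_simp
    intro k hk
    rcases k with _ | k
    · exact h0
    · exact ih _ hshift k (by omega)

/-! ### Moments of the centred log. -/

variable {α θ : ℝ} {ν : Measure ℝ}

/-- The logarithm, centered at the mean of the log of a Mittag-Leffler variable. -/
noncomputable def centeredLog (α θ t : ℝ) : ℝ :=
  Real.log t + Real.log θ / α + Real.eulerMascheroniConstant

lemma measurable_centeredLog : Measurable (centeredLog α θ) := by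
  unfold centeredLog; fun_prop

lemma IsMittagLefflerLaw.zero_mem_interior (hα : 0 < α) (hθ : 0 < θ)
    (h : IsMittagLefflerLaw α θ ν) :
    0 ∈ interior (integrableExpSet (centeredLog α θ) ν) := by
  refine interior_maximal (fun r hr => ?_) isOpen_Ioo
    (show (0 : ℝ) ∈ Set.Ioo (-α) α from ⟨by linarith, hα⟩)
  have := Integrable.const_mul (h.integrableExpSet_log hα hθ hr)
    (Real.exp (r * (Real.log θ / α + Real.eulerMascheroniConstant)))
  refine this.congr (ae_of_all _ fun t => ?_)
  simp only [centeredLog]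
  rw [← Real.exp_add]
  congr 1
  ring

/-- Centring removes θ^(s/α) and the linear term. In log Γ(1 + s/α) + log Γ(1 - s/α) odd powers
cancel, so the cubic term comes from Γ(1 + s) alone and is free of α. -/
lemma IsMittagLefflerLaw.isBigO_mgf_centeredLog (hα : 0 < α) (hθ : 0 < θ)
    (h : IsMittagLefflerLaw α θ ν) :
    (fun s => mgf (centeredLog α θ) ν (-s) -
      (1 + (Real.pi ^ 2 / (6 * α ^ 2) - Real.pi ^ 2 / 12) * s ^ 2 + (riemannZeta 3).re / 3 * s ^ 3 +
        (Real.pi ^ 4 / (180 * α ^ 4) - Real.pi ^ 4 / 360 +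
          (Real.pi ^ 2 / (6 * α ^ 2) - Real.pi ^ 2 / 12) ^ 2 / 2) * s ^ 4)) =O[𝓝[>] 0]
      fun s => s ^ 5 := by
  set lg : ℝ → ℝ := fun s => Real.log (Real.Gamma (1 + s)) with hlg
  set g : ℝ → ℝ := fun s =>
    -s * Real.eulerMascheroniConstant + lg (s / α) + lg (-(s / α)) - lg s with hg
  have hgO : (fun s => g s - ((Real.pi ^ 2 / (6 * α ^ 2) - Real.pi ^ 2 / 12) * s ^ 2 +
      (riemannZeta 3).re / 3 * s ^ 3 + (Real.pi ^ 4 / (180 * α ^ 4) - Real.pi ^ 4 / 360) * s ^ 4))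
      =O[𝓝 0] fun s => s ^ 5 := by
    have hscale (c : ℝ) : (fun s => lg (c * s) - logGammaTaylor (c * s)) =O[𝓝 0]
        fun s => s ^ 5 := by
      have ht : Tendsto (fun s : ℝ => c * s) (𝓝 0) (𝓝 0) := by
        simpa using (continuous_const_mul c).tendsto (0 : ℝ)
      have h1 := isBigO_log_Gamma_one_add_sub.comp_tendsto ht
      refine h1.trans ?_
      simp only [Function.comp_def, mul_pow]
      exact (Asymptotics.isBigO_refl _ _).const_mul_left _
    refine (((hscale α⁻¹).add (hscale (-α⁻¹))).sub (hscale 1)).congr_left fun s => ?_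
    simp only [hg, logGammaTaylor, one_mul, neg_mul, ← div_eq_inv_mul]
    field_simp
    ring
  refine (isBigO_exp_sub_of_isBigO nhdsWithin_le_nhds
    (hgO.mono nhdsWithin_le_nhds)).congr' ?_ EventuallyEq.rfl
  filter_upwards [Ioo_mem_nhdsGT hα] with s hs
  have hs0 : 0 < s := hs.1
  have hu : s / α < 1 := (div_lt_one hα).2 hs.2
  have hmgf : mgf (centeredLog α θ) ν (-s) =
      mgf Real.log ν (-s) * Real.exp (-s * (Real.log θ / α + Real.eulerMascheroniConstant)) := by
    rw [← mgf_add_const]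
    congr 1
    ext t
    simp only [centeredLog]; ring
  have h1 := Real.Gamma_pos_of_pos (show 0 < 1 + s / α by positivity)
  have h2 := Real.Gamma_pos_of_pos (show 0 < 1 + -(s / α) by linarith)
  have h3 := Real.Gamma_pos_of_pos (show 0 < 1 + s by positivity)
  rw [hmgf, h.mgf_log_neg hα hθ hs0 hs.2]
  congr 1
  simp only [hg, hlg]
  rw [Real.exp_sub, Real.exp_add, Real.exp_add, Real.exp_log h1, Real.exp_log h2, Real.exp_log h3,
    mul_add, Real.exp_add, Real.rpow_def_of_pos hθ,
    show -s * (Real.log θ / α) = -(Real.log θ * (s / α)) by ring, Real.exp_neg, ← sub_eq_add_neg]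
  have := (Real.exp_pos (Real.log θ * (s / α))).ne'
  field_simp

/-- The first four moments of the centered log of a Mittag-Leffler variable. -/
lemma IsMittagLefflerLaw.moments_centeredLog (hα : 0 < α) (hθ : 0 < θ)
    (h : IsMittagLefflerLaw α θ ν) :
    ∫ t, centeredLog α θ t ∂ν = 0 ∧
    ∫ t, centeredLog α θ t ^ 2 ∂ν = Real.pi ^ 2 / (3 * α ^ 2) - Real.pi ^ 2 / 6 ∧
    ∫ t, centeredLog α θ t ^ 3 ∂ν = -2 * (riemannZeta 3).re ∧
    ∫ t, centeredLog α θ t ^ 4 ∂ν = 2 * Real.pi ^ 4 / (15 * α ^ 4) - Real.pi ^ 4 / 15 +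
      3 * (Real.pi ^ 2 / (3 * α ^ 2) - Real.pi ^ 2 / 6) ^ 2 := by
  have := h.1
  have hps := (hasFPowerSeriesAt_mgf (h.zero_mem_interior hα hθ)).isBigO_sub_partialSum_pow 5
  have hneg : Tendsto (fun s : ℝ => -s) (𝓝[>] 0) (𝓝 0) := by
    have : Tendsto (fun s : ℝ => -s) (𝓝 0) (𝓝 0) := by simpa using continuous_neg.tendsto (0 : ℝ)
    exact this.mono_left nhdsWithin_le_nhds
  have hps' := hps.comp_tendsto hneg
  have hright : ((fun y : ℝ => ‖y‖ ^ 5) ∘ fun s : ℝ => -s) =O[𝓝[>] 0] fun s => s ^ 5 := by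
    simp only [Function.comp_def, norm_neg]
    exact Asymptotics.isBigO_of_le _ fun s => by simp
  have hdiff := (h.isBigO_mgf_centeredLog hα hθ).sub (hps'.trans hright)
  set M : ℕ → ℝ := fun n => ∫ t, centeredLog α θ t ^ n ∂ν with hM
  have hM0 : M 0 = 1 := by simp [hM]
  -- Coefficients of the moment series minus the explicit expansion; odd moments carry a minus sign
  -- because the generating function is taken at -s.
  set d : ℕ → ℝ := fun k => match k with
    | 0 => 0
    | 1 => -M 1
    | 2 => M 2 / 2 - (Real.pi ^ 2 / (6 * α ^ 2) - Real.pi ^ 2 / 12)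
    | 3 => -M 3 / 6 - (riemannZeta 3).re / 3
    | 4 => M 4 / 24 - (Real.pi ^ 4 / (180 * α ^ 4) - Real.pi ^ 4 / 360 +
          (Real.pi ^ 2 / (6 * α ^ 2) - Real.pi ^ 2 / 12) ^ 2 / 2)
    | _ => 0 with hd
  have hzero := coeff_eq_zero_of_isBigO_pow 5 d (hdiff.congr_left fun s => by
    simp only [Function.comp_def, zero_add, FormalMultilinearSeries.partialSum,
      FormalMultilinearSeries.ofScalars_apply_eq, Finset.sum_range_succ, Finset.sum_range_zero,
      zero_mul, Real.exp_zero, mul_one, smul_eq_mul]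
    change _ - (mgf (centeredLog α θ) ν (-s) - (M 0 / _ * _ + M 1 / _ * _ + M 2 / _ * _ +
      M 3 / _ * _ + M 4 / _ * _)) = _
    rw [hM0]
    simp only [hd, Nat.factorial]
    push_cast
    ring)
  have h1 := hzero 1 (by norm_num)
  have h2 := hzero 2 (by norm_num)
  have h3 := hzero 3 (by norm_num)
  have h4 := hzero 4 (by norm_num)
  simp only [hd] at h1 h2 h3 h4
  refine ⟨?_, ?_, ?_, ?_⟩
  · have : M 1 = 0 := by linarith
    simpa [hM] using this
  · change M 2 = _
    linear_combination 2 * h2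
  · change M 3 = _
    linear_combination -6 * h3
  · change M 4 = _
    linear_combination 24 * h4

lemma IsMittagLefflerLaw.integrable_centeredLog_pow (hα : 0 < α) (hθ : 0 < θ)
    (h : IsMittagLefflerLaw α θ ν) (n : ℕ) : Integrable (fun t => centeredLog α θ t ^ n) ν :=
  integrable_pow_of_mem_interior_integrableExpSet (h.zero_mem_interior hα hθ) n

end

/-! ### Independence of pairs, boundedness in probability and the delta method. -/

section Probability

variable {Ω : Type*} [MeasurableSpace Ω] {P : Measure Ω}

/-- Families that are independent within themselves and of each other form an independent family
of pairs. -/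
lemma iIndepFun_prodMk {ι β γ : Type*} [MeasurableSpace β] [MeasurableSpace γ]
    {X : ι → Ω → β} {Y : ι → Ω → γ} (mX : ∀ i, Measurable (X i)) (mY : ∀ i, Measurable (Y i))
    (hX : iIndepFun X P) (hY : iIndepFun Y P)
    (hXY : IndepFun (fun ω i => X i ω) (fun ω i => Y i ω) P) :
    iIndepFun (fun i ω => (X i ω, Y i ω)) P := by
  rw [iIndepFun_iff_iIndep]
  -- Measurable rectangles form a generating π-system. On them the event splits into one about X and
  -- one about Y, so `hXY` factors it before `hX` and `hY` do.
  set R : Set (Set (β × γ)) :=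
    Set.image2 (· ×ˢ ·) {s | MeasurableSet s} {t | MeasurableSet t} with hR
  refine iIndepSets.iIndep (fun i => ((mX i).prodMk (mY i)).comap_le)
    (fun i => Set.preimage (fun ω => (X i ω, Y i ω)) '' R) (fun i => ?_) (fun i => ?_) ?_
  · rintro _ ⟨s, hs, rfl⟩ _ ⟨t, ht, rfl⟩ hst
    obtain ⟨ω, hω⟩ := hst
    exact ⟨s ∩ t, isPiSystem_prod s hs t ht ⟨_, hω⟩, rfl⟩
  · rw [← MeasurableSpace.comap_generateFrom, hR, generateFrom_prod]
  · rw [iIndepSets_iff]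
    intro s f hf
    have hf' : ∀ i : ι, ∃ (a : Set β) (b : Set γ), MeasurableSet a ∧ MeasurableSet b ∧
        (i ∈ s → f i = X i ⁻¹' a ∩ Y i ⁻¹' b) := fun i => by
      by_cases hi : i ∈ s
      · obtain ⟨_, ⟨a, ha, b, hb, rfl⟩, h⟩ := hf i hi
        exact ⟨a, b, ha, hb, fun _ => h ▸ rfl⟩
      · exact ⟨∅, ∅, .empty, .empty, fun h => absurd h hi⟩
    choose a b ha hb hfab using hf'
    have h1 : ⋂ i ∈ s, f i = (fun ω i => X i ω) ⁻¹' Set.pi s a ∩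
        (fun ω i => Y i ω) ⁻¹' Set.pi s b := by
      rw [Set.iInter₂_congr hfab]
      ext ω
      simp only [Set.mem_iInter, Set.mem_inter_iff, Set.mem_preimage, Set.mem_pi, Finset.mem_coe]
      exact ⟨fun h => ⟨fun i hi => (h i hi).1, fun i hi => (h i hi).2⟩,
        fun h i hi => ⟨h.1 i hi, h.2 i hi⟩⟩
    have hpX : (fun ω i => X i ω) ⁻¹' Set.pi s a = ⋂ i ∈ s, X i ⁻¹' a i := by ext ω; simp
    have hpY : (fun ω i => Y i ω) ⁻¹' Set.pi s b = ⋂ i ∈ s, Y i ⁻¹' b i := by ext ω; simp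
    rw [h1, hXY.measure_inter_preimage_eq_mul _ _
      (MeasurableSet.pi s.countable_toSet fun i _ => ha i)
      (MeasurableSet.pi s.countable_toSet fun i _ => hb i), hpX, hpY,
      hX.measure_inter_preimage_eq_mul s (fun i _ => ha i),
      hY.measure_inter_preimage_eq_mul s (fun i _ => hb i), ← Finset.prod_mul_distrib]
    refine Finset.prod_congr rfl fun i hi => ?_
    rw [hfab i hi]
    exact ((hXY.comp (measurable_pi_apply i) (measurable_pi_apply i)).measure_inter_preimage_eq_mul
      _ _ (ha i) (hb i)).symm

/-- A sequence of random variables is bounded in probability. -/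
def BddInProbability {E : Type*} [Norm E] (P : Measure Ω) (X : ℕ → Ω → E) : Prop :=
  ∀ ε : ℝ≥0∞, 0 < ε → ∃ M : ℝ, ∀ᶠ n in atTop, P {ω | M < ‖X n ω‖} ≤ ε

lemma BddInProbability.prodMk {E F : Type*} [SeminormedAddCommGroup E] [SeminormedAddCommGroup F]
    {X : ℕ → Ω → E} {Y : ℕ → Ω → F} (hX : BddInProbability P X) (hY : BddInProbability P Y) :
    BddInProbability P fun n ω => (X n ω, Y n ω) := by
  intro ε hε
  obtain ⟨M, hM⟩ := hX (ε / 2) (ENNReal.half_pos hε.ne')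
  obtain ⟨M', hM'⟩ := hY (ε / 2) (ENNReal.half_pos hε.ne')
  refine ⟨max M M', ?_⟩
  filter_upwards [hM, hM'] with n h h'
  calc P {ω | max M M' < ‖(X n ω, Y n ω)‖}
      ≤ P ({ω | M < ‖X n ω‖} ∪ {ω | M' < ‖Y n ω‖}) := by
        refine measure_mono fun ω hω => ?_
        rcases lt_max_iff.1 (show max M M' < max ‖X n ω‖ ‖Y n ω‖ from hω) with h | h
        · exact Or.inl ((le_max_left _ _).trans_lt h)
        · exact Or.inr ((le_max_right _ _).trans_lt h)
    _ ≤ ε / 2 + ε / 2 := (measure_union_le _ _).trans (add_le_add h h')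
    _ = ε := ENNReal.add_halves ε

lemma bddInProbability_const_of_tendsto {c : ℕ → ℝ} {a : ℝ} (hc : Tendsto c atTop (𝓝 a)) :
    BddInProbability P fun n (_ : Ω) => c n := by
  refine fun ε _ => ⟨‖a‖ + 1, ?_⟩
  filter_upwards [hc.norm.eventually (gt_mem_nhds (lt_add_one ‖a‖))] with n hn
  rw [show {ω : Ω | ‖a‖ + 1 < ‖c n‖} = ∅ by
    ext ω; simpa using hn.le]
  simp

/-- Chebyshev's inequality: the rescaled mean has the same variance for every n > 0. -/
lemma bddInProbability_sqrt_mul_mean_sub [IsProbabilityMeasure P] {X : ℕ → Ω → ℝ}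
    (hX : MemLp (X 0) 2 P) (hindep : iIndepFun X P)
    (hident : ∀ i, IdentDistrib (X i) (X 0) P P) :
    BddInProbability P fun n ω =>
      Real.sqrt n * ((∑ k ∈ Finset.range n, X k ω) / n - ∫ ω, X 0 ω ∂P) := by
  intro ε hε
  rcases eq_or_ne ε ∞ with rfl | hεtop
  · exact ⟨0, Eventually.of_forall fun n => le_top⟩
  have hε' : 0 < ε.toReal := ENNReal.toReal_pos hε.ne' hεtop
  set v := Var[X 0; P] with hv
  have hv0 : 0 ≤ v := variance_nonneg _ _
  -- Using v + 1 instead of v keeps M positive when the variance vanishes.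
  set M := Real.sqrt ((v + 1) / ε.toReal) with hM
  have hMpos : 0 < M := by positivity
  refine ⟨M, ?_⟩
  filter_upwards [eventually_gt_atTop 0] with n hn
  have hn' : (0 : ℝ) < n := by exact_mod_cast hn
  have hmem (k : ℕ) : MemLp (X k) 2 P := (hident k).memLp_iff.2 hX
  have hvar : Var[∑ k ∈ Finset.range n, X k; P] = n * v := by
    rw [IndepFun.variance_sum (fun k _ => hmem k) fun i _ j _ hij => hindep.indepFun hij]
    simp [fun k => (hident k).variance_eq, hv]
  have hmean : P[∑ k ∈ Finset.range n, X k] = n * ∫ ω, X 0 ω ∂P := by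
    simp only [Finset.sum_apply]
    rw [integral_finsetSum _ fun k _ => (hmem k).integrable one_le_two]
    simp [fun k => (hident k).integral_eq]
  have hcheb := meas_ge_le_variance_div_sq (memLp_finsetSum' (Finset.range n) fun k _ => hmem k)
    (c := Real.sqrt n * M) (by positivity)
  rw [hvar, hmean] at hcheb
  refine (measure_mono fun ω hω => ?_).trans (hcheb.trans ?_)
  · have hω : M < ‖Real.sqrt n * ((∑ k ∈ Finset.range n, X k ω) / n - ∫ ω, X 0 ω ∂P)‖ := hω
    simp only [Set.mem_ofPred_eq, Finset.sum_apply]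
    have heq : (∑ k ∈ Finset.range n, X k ω) - n * ∫ ω, X 0 ω ∂P =
        Real.sqrt n * (Real.sqrt n * ((∑ k ∈ Finset.range n, X k ω) / n - ∫ ω, X 0 ω ∂P)) := by
      rw [← mul_assoc, Real.mul_self_sqrt hn'.le]
      field_simp
    rw [heq, abs_mul, abs_of_nonneg (Real.sqrt_nonneg _)]
    exact mul_le_mul_of_nonneg_left hω.le (Real.sqrt_nonneg _)
  · rw [ENNReal.ofReal_le_iff_le_toReal hεtop, mul_pow, Real.sq_sqrt hn'.le,
      mul_div_mul_left _ _ hn'.ne', hM, Real.sq_sqrt (by positivity), div_div_eq_mul_div,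
      div_le_iff₀ (by positivity)]
    nlinarith

/-- The remainder in the delta method is negligible. -/
lemma tendstoInMeasure_sqrt_mul_remainder {E : Type*} [NormedAddCommGroup E] [NormedSpace ℝ E]
    {H : E → ℝ} {A : E →L[ℝ] ℝ} {z₀ : E} (hH : HasFDerivAt H A z₀) {Z : ℕ → Ω → E}
    (hZ : BddInProbability P fun n ω => Real.sqrt n • (Z n ω - z₀)) :
    TendstoInMeasure P
      (fun (n : ℕ) ω => Real.sqrt n * (H (Z n ω) - H z₀ - A (Z n ω - z₀))) atTop 0 := by
  rw [tendstoInMeasure_iff_norm]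
  intro ε hε
  rw [ENNReal.tendsto_nhds_zero]
  intro δ hδ
  obtain ⟨M, hM⟩ := hZ δ hδ
  have hM' : 0 < max M 1 := one_pos.trans_le (le_max_right _ _)
  -- With this constant the scaled remainder is at most ε/2 wherever √n ‖Z - z₀‖ ≤ M, once √n ρ >
  -- max M 1 puts Z in the ρ-ball.
  have hlit := (hasFDerivAt_iff_isLittleO.1 hH).def (c := ε / (2 * max M 1)) (by positivity)
  obtain ⟨ρ, hρ, hball⟩ := Metric.eventually_nhds_iff.1 hlit
  have hlarge : ∀ᶠ n : ℕ in atTop, max M 1 < Real.sqrt n * ρ :=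
    ((Real.tendsto_sqrt_atTop.comp tendsto_natCast_atTop_atTop).atTop_mul_const hρ).eventually
      (eventually_gt_atTop _)
  filter_upwards [hM, hlarge] with n hn hnρ
  refine (measure_mono fun ω hω => ?_).trans hn
  have hω : ε ≤ ‖Real.sqrt n * (H (Z n ω) - H z₀ - A (Z n ω - z₀)) - 0‖ := hω
  simp only [Set.mem_ofPred_eq]
  by_contra! hcon
  rw [norm_smul, Real.norm_of_nonneg (Real.sqrt_nonneg _)] at hcon
  have hcon' := hcon.trans (le_max_left M 1)
  have hsq : 0 < Real.sqrt n := by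
    by_contra h0
    have := (Real.sqrt_nonneg (n : ℝ)).antisymm' (not_lt.1 h0)
    rw [this, zero_mul] at hnρ
    linarith
  have hdist : dist (Z n ω) z₀ < ρ := by
    rw [dist_eq_norm]
    exact lt_of_mul_lt_mul_left (hcon'.trans_lt hnρ) hsq.le
  have hb := hball hdist
  rw [sub_zero, norm_mul, Real.norm_of_nonneg hsq.le] at hω
  have : Real.sqrt n * ‖H (Z n ω) - H z₀ - A (Z n ω - z₀)‖ ≤ ε / 2 := by
    calc _ ≤ Real.sqrt n * (ε / (2 * max M 1) * ‖Z n ω - z₀‖) := by gcongr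
      _ = ε / (2 * max M 1) * (Real.sqrt n * ‖Z n ω - z₀‖) := by ring
      _ ≤ ε / (2 * max M 1) * max M 1 := by gcongr
      _ = ε / 2 := by field_simp
  linarith

lemma tendstoInMeasure_const_of_tendsto {c : ℕ → ℝ} (hc : Tendsto c atTop (𝓝 0)) :
    TendstoInMeasure P (fun n (_ : Ω) => c n) atTop 0 := by
  rw [tendstoInMeasure_iff_norm]
  intro ε hε
  refine tendsto_const_nhds.congr' ?_
  filter_upwards [hc.norm.eventually (gt_mem_nhds (by simpa using hε))] with n hn
  rw [show {ω : Ω | ε ≤ ‖c n - (0 : Ω → ℝ) ω‖} = ∅ by ext ω; simpa using hn]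
  simp

lemma tendstoInMeasure_add {f g : ℕ → Ω → ℝ} (hf : TendstoInMeasure P f atTop 0)
    (hg : TendstoInMeasure P g atTop 0) :
    TendstoInMeasure P (fun n ω => f n ω + g n ω) atTop 0 := by
  rw [tendstoInMeasure_iff_norm] at hf hg ⊢
  intro ε hε
  have hsum := (hf (ε / 2) (half_pos hε)).add (hg (ε / 2) (half_pos hε))
  rw [add_zero] at hsum
  refine tendsto_of_tendsto_of_tendsto_of_le_of_le tendsto_const_nhds hsum (fun _ => zero_le)
    fun n => (measure_mono fun ω hω => ?_).trans (measure_union_le _ _)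
  by_contra hcon
  simp only [Set.mem_union, Set.mem_ofPred_eq, Pi.zero_apply, sub_zero, not_or, not_le] at hcon hω
  linarith [norm_add_le (f n ω) (g n ω)]

end Probability

/-! ### The influence function of the estimator of θ and its variance. -/

section Influence

variable {α θ : ℝ} {ν : Measure ℝ}

/-- The variance of the log of a Mittag-Leffler variable. -/
noncomputable def logVariance (α : ℝ) : ℝ := Real.pi ^ 2 / (3 * α ^ 2) - Real.pi ^ 2 / 6

/-- The sensitivity of `log thetaHat` to the sample variance. -/
noncomputable def varianceSlope (α θ : ℝ) : ℝ := -(3 / 2) * Real.log θ * α ^ 2 / Real.pi ^ 2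

/-- The influence function of `thetaHat`. -/
noncomputable def thetaInfluence (α θ t : ℝ) : ℝ :=
  θ * (-(α * centeredLog α θ t) + varianceSlope α θ * (centeredLog α θ t ^ 2 - logVariance α))

lemma measurable_thetaInfluence : Measurable (thetaInfluence α θ) := by
  have := measurable_centeredLog (α := α) (θ := θ)
  unfold thetaInfluence
  fun_prop

/-- Expanded in powers of the centred log, so that integrability and the integral both follow from
its first four moments. -/
lemma thetaInfluence_sq (α θ t : ℝ) : thetaInfluence α θ t ^ 2 =
    θ ^ 2 * varianceSlope α θ ^ 2 * logVariance α ^ 2 +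
    θ ^ 2 * 2 * α * varianceSlope α θ * logVariance α * centeredLog α θ t ^ 1 +
    θ ^ 2 * (α ^ 2 - 2 * varianceSlope α θ ^ 2 * logVariance α) * centeredLog α θ t ^ 2 +
    θ ^ 2 * (-2 * α * varianceSlope α θ) * centeredLog α θ t ^ 3 +
    θ ^ 2 * varianceSlope α θ ^ 2 * centeredLog α θ t ^ 4 := by
  rw [thetaInfluence]; ring

lemma IsMittagLefflerLaw.integrable_thetaInfluence_sq (hα : 0 < α) (hθ : 0 < θ)
    (h : IsMittagLefflerLaw α θ ν) : Integrable (fun t => thetaInfluence α θ t ^ 2) ν := by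
  have := h.1
  have hi := h.integrable_centeredLog_pow hα hθ
  simp_rw [thetaInfluence_sq]
  exact ((((integrable_const _).add ((hi 1).const_mul _)).add ((hi 2).const_mul _)).add
    ((hi 3).const_mul _)).add ((hi 4).const_mul _)

lemma IsMittagLefflerLaw.memLp_thetaInfluence (hα : 0 < α) (hθ : 0 < θ)
    (h : IsMittagLefflerLaw α θ ν) : MemLp (thetaInfluence α θ) 2 ν :=
  (memLp_two_iff_integrable_sq measurable_thetaInfluence.aestronglyMeasurable).2
    (h.integrable_thetaInfluence_sq hα hθ)

lemma IsMittagLefflerLaw.integral_thetaInfluence (hα : 0 < α) (hθ : 0 < θ)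
    (h : IsMittagLefflerLaw α θ ν) : ∫ t, thetaInfluence α θ t ∂ν = 0 := by
  have := h.1
  obtain ⟨m1, m2, -, -⟩ := h.moments_centeredLog hα hθ
  have i1 : Integrable (centeredLog α θ) ν := by
    simpa using h.integrable_centeredLog_pow hα hθ 1
  have i2 := h.integrable_centeredLog_pow hα hθ 2
  simp only [thetaInfluence]
  rw [integral_const_mul, integral_add (by fun_prop) (by fun_prop), integral_neg,
    integral_const_mul, integral_const_mul, integral_sub i2 (integrable_const _), m1, m2]
  simp [logVariance]

lemma IsMittagLefflerLaw.integral_thetaInfluence_sq (hα : 0 < α) (hθ : 0 < θ)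
    (h : IsMittagLefflerLaw α θ ν) :
    ∫ t, thetaInfluence α θ t ^ 2 ∂ν = sigmaThetaSq α θ := by
  have := h.1
  obtain ⟨m1, m2, m3, m4⟩ := h.moments_centeredLog hα hθ
  have m1' : ∫ t, centeredLog α θ t ^ 1 ∂ν = 0 := by simpa using m1
  have hi := h.integrable_centeredLog_pow hα hθ
  simp_rw [thetaInfluence_sq]
  have i1 := hi 1
  have i2 := hi 2
  have i3 := hi 3
  have i4 := hi 4
  rw [integral_add (by fun_prop) (by fun_prop), integral_add (by fun_prop) (by fun_prop),
    integral_add (by fun_prop) (by fun_prop), integral_add (by fun_prop) (by fun_prop),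
    integral_const, probReal_univ, one_smul,
    integral_const_mul, integral_const_mul, integral_const_mul, integral_const_mul,
    m1', m2, m3, m4, sigmaThetaSq, varianceSlope, logVariance]
  have := Real.pi_ne_zero
  field_simp
  ring

end Influence

/-! ### The derivative of the estimator at the true moments. -/

section DeltaMethod

/-- The estimator of `mu` as a function of the death frequency, the first two empirical moments of
the centered logs, and the normalisation of the sample variance; `c` is `log θ / α`. -/
noncomputable def momentEstimator (c : ℝ) (z : ℝ × ℝ × ℝ × ℝ) : ℝ :=
  z.1 * Real.exp (-(Real.pi / Real.sqrt (3 * (z.2.2.2 * (z.2.2.1 - z.2.1 ^ 2) + Real.pi ^ 2 / 6)) *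
    (z.2.1 - c)))

lemma three_mul_logVariance_add {α : ℝ} (hα : 0 < α) :
    3 * (logVariance α + Real.pi ^ 2 / 6) = (Real.pi / α) ^ 2 := by
  rw [logVariance]; field_simp; ring

lemma hasDerivAt_pi_div_sqrt {α : ℝ} (hα : 0 < α) :
    HasDerivAt (fun w => Real.pi / Real.sqrt (3 * (w + Real.pi ^ 2 / 6)))
      (-(3 / 2) * α ^ 3 / Real.pi ^ 2) (logVariance α) := by
  have hpos : 0 < Real.pi / α := by positivity
  have hsqrt : Real.sqrt (3 * (logVariance α + Real.pi ^ 2 / 6)) = Real.pi / α := by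
    rw [three_mul_logVariance_add hα, Real.sqrt_sq hpos.le]
  have h1 : HasDerivAt (fun w : ℝ => 3 * (w + Real.pi ^ 2 / 6)) (3 * 1) (logVariance α) :=
    ((hasDerivAt_id _).add_const _).const_mul 3
  have h2 := h1.sqrt (by rw [three_mul_logVariance_add hα]; positivity)
  have h3 := (hasDerivAt_const (logVariance α) Real.pi).fun_div h2 (by rw [hsqrt]; exact hpos.ne')
  refine h3.congr_deriv ?_
  rw [hsqrt]
  have := Real.pi_ne_zero
  field_simp
  ring

lemma pi_div_sqrt_logVariance {α : ℝ} (hα : 0 < α) :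
    Real.pi / Real.sqrt (3 * (logVariance α + Real.pi ^ 2 / 6)) = α := by
  rw [three_mul_logVariance_add hα, Real.sqrt_sq (by positivity)]
  field_simp

lemma momentEstimator_apply {α θ q : ℝ} (hα : 0 < α) (hθ : 0 < θ) :
    momentEstimator (Real.log θ / α) (q, 0, logVariance α, 1) = q * θ := by
  simp only [momentEstimator]
  rw [one_mul, zero_pow two_ne_zero, sub_zero, pi_div_sqrt_logVariance hα, zero_sub, mul_neg,
    neg_neg, mul_div_cancel₀ _ hα.ne', Real.exp_log hθ]

/-- The squared mean drops out because its derivative vanishes at 0. Moving the variance changes the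
exponent by log θ / α times the slope -(3/2) α³/π² of the estimator of α, which is `varianceSlope`.
-/
lemma hasFDerivAt_momentEstimator {α θ q : ℝ} (hα : 0 < α) (hθ : 0 < θ) :
    ∃ A : (ℝ × ℝ × ℝ × ℝ) →L[ℝ] ℝ,
      HasFDerivAt (momentEstimator (Real.log θ / α)) A (q, 0, logVariance α, 1) ∧
      ∀ h, A h = θ * h.1 + q * (θ * (-(α * h.2.1) +
        varianceSlope α θ * (h.2.2.1 + logVariance α * h.2.2.2))) := by
  set z₀ : ℝ × ℝ × ℝ × ℝ := (q, 0, logVariance α, 1) with hz₀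
  have p1 : HasFDerivAt (fun z : ℝ × ℝ × ℝ × ℝ => z.1)
      (ContinuousLinearMap.fst ℝ ℝ (ℝ × ℝ × ℝ)) z₀ := hasFDerivAt_fst
  have q1 : HasFDerivAt (fun z : ℝ × ℝ × ℝ × ℝ => z.2)
      (ContinuousLinearMap.snd ℝ ℝ (ℝ × ℝ × ℝ)) z₀ := hasFDerivAt_snd
  have p2 := q1.fst
  have q2 := q1.snd
  have p3 := q2.fst
  have p4 := q2.snd
  have hw := p4.mul (p3.sub (p2.pow 2))
  -- Kept opaque, so that only its value α and its derivative at the true variance enter the final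
  -- simplification.
  obtain ⟨g, hg⟩ : ∃ g : ℝ → ℝ,
    g = fun w => Real.pi / Real.sqrt (3 * (w + Real.pi ^ 2 / 6)) := ⟨_, rfl⟩
  have hG' := hasDerivAt_pi_div_sqrt hα
  have hpi := pi_div_sqrt_logVariance hα
  have hest : momentEstimator (Real.log θ / α) = fun z => z.1 *
      Real.exp (-(g (z.2.2.2 * (z.2.2.1 - z.2.1 ^ 2)) * (z.2.1 - Real.log θ / α))) := by
    rw [hg]; rfl
  rw [← hg] at hG'
  change (fun w => Real.pi / Real.sqrt (3 * (w + Real.pi ^ 2 / 6))) (logVariance α) = α at hpi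
  rw [← hg] at hpi
  rw [hest]
  rw [show logVariance α = (fun z : ℝ × ℝ × ℝ × ℝ => z.2.2.2 * (z.2.2.1 - z.2.1 ^ 2)) z₀ by
    simp [hz₀]] at hG'
  have hG := hG'.comp_hasFDerivAt z₀ hw
  have hE := ((hG.mul (p2.sub_const (Real.log θ / α))).neg).exp
  have hH := p1.mul hE
  refine ⟨_, hH, fun h => ?_⟩
  have hexp : Real.exp (α * (Real.log θ / α)) = θ := by
    rw [mul_div_cancel₀ _ hα.ne', Real.exp_log hθ]
  simp [hz₀, hpi, hexp, varianceSlope]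
  field_simp
  ring

end DeltaMethod

/-! ### Writing the estimator in terms of the empirical moments. -/

section EventData

variable {Ω : Type*} {N : ℝ → Ω → ℤ} {S : ℕ → Ω → ℝ}

lemma logMean_eq {α θ : ℝ} {n : ℕ} (hn : n ≠ 0) (ω : Ω) :
    logMean S n ω = (∑ k ∈ Finset.range n, centeredLog α θ (S k ω)) / n - Real.log θ / α -
      Real.eulerMascheroniConstant := by
  have hn' : (n : ℝ) ≠ 0 := by exact_mod_cast hn
  simp only [logMean, centeredLog, Finset.sum_add_distrib, Finset.sum_const, Finset.card_range,
    nsmul_eq_mul]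
  field_simp
  ring

/-- The sample variance is translation invariant, so the logs may be centred. For n = d both sides
are 0 by the convention on division by zero. -/
lemma logVar_eq {α θ : ℝ} (d : ℕ) {n : ℕ} (hn : n ≠ 0) (ω : Ω) :
    logVar d S n ω = n / ((n : ℝ) - d) *
      ((∑ k ∈ Finset.range n, centeredLog α θ (S k ω) ^ 2) / n -
        ((∑ k ∈ Finset.range n, centeredLog α θ (S k ω)) / n) ^ 2) := by
  have hn' : (n : ℝ) ≠ 0 := by exact_mod_cast hn
  set m := (∑ k ∈ Finset.range n, centeredLog α θ (S k ω)) / n with hm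
  have hsum : ∑ k ∈ Finset.range n, centeredLog α θ (S k ω) = n * m := by
    rw [hm]; field_simp
  have hterm : ∀ k, (Real.log (S k ω) - logMean S n ω) ^ 2 =
      centeredLog α θ (S k ω) ^ 2 - 2 * m * centeredLog α θ (S k ω) + m ^ 2 := fun k => by
    rw [logMean_eq (α := α) (θ := θ) hn, ← hm, centeredLog]; ring
  rw [logVar, Finset.sum_congr rfl fun k _ => hterm k, Finset.sum_add_distrib,
    Finset.sum_sub_distrib, ← Finset.mul_sum, hsum, Finset.sum_const, Finset.card_range,
    nsmul_eq_mul, div_mul_eq_mul_div]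
  congr 1
  field_simp
  ring

/-- The indicator of a death at the `(k+1)`-st event. -/
noncomputable def deathIndicator (N : ℝ → Ω → ℤ) (S : ℕ → Ω → ℝ) (k : ℕ) : Ω → ℝ :=
  {ω | step N S k ω = -1}.indicator 1

/-- The empirical quantities that determine `muHat`. -/
noncomputable def empiricalMoments (α θ : ℝ) (d : ℕ) (N : ℝ → Ω → ℤ) (S : ℕ → Ω → ℝ) (n : ℕ)
    (ω : Ω) : ℝ × ℝ × ℝ × ℝ :=
  ((∑ k ∈ Finset.range n, deathIndicator N S k ω) / n,
    (∑ k ∈ Finset.range n, centeredLog α θ (S k ω)) / n,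
    (∑ k ∈ Finset.range n, centeredLog α θ (S k ω) ^ 2) / n, n / ((n : ℝ) - d))

lemma cast_numDeaths (n : ℕ) (ω : Ω) :
    (numDeaths N S n ω : ℝ) = ∑ k ∈ Finset.range n, deathIndicator N S k ω := by
  simp [numDeaths, deathIndicator, Set.indicator_apply]

lemma muHat_eq {α θ : ℝ} (d : ℕ) {n : ℕ} (hn : n ≠ 0) (ω : Ω) :
    muHat d N S n ω = momentEstimator (Real.log θ / α) (empiricalMoments α θ d N S n ω) := by
  rw [muHat, thetaHat, alphaHat, momentEstimator, empiricalMoments, cast_numDeaths,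
    logVar_eq (α := α) (θ := θ) d hn, logMean_eq (α := α) (θ := θ) hn, sub_add_cancel]

variable [MeasurableSpace Ω] {P : Measure Ω}

lemma identDistrib_indicator_one [IsProbabilityMeasure P] {E F : Set Ω} (hE : MeasurableSet E)
    (hF : MeasurableSet F) (h : P E = P F) :
    IdentDistrib (E.indicator (1 : Ω → ℝ)) (F.indicator (1 : Ω → ℝ)) P P := by
  have mE : Measurable (E.indicator (1 : Ω → ℝ)) := measurable_one.indicator hE
  have mF : Measurable (F.indicator (1 : Ω → ℝ)) := measurable_one.indicator hF
  refine ⟨mE.aemeasurable, mF.aemeasurable, Measure.ext fun A hA => ?_⟩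
  have hpre (G : Set Ω) : G.indicator (1 : Ω → ℝ) ⁻¹' A =
      {ω | (ω ∈ G ∧ (1 : ℝ) ∈ A) ∨ (ω ∈ Gᶜ ∧ (0 : ℝ) ∈ A)} := by
    ext ω
    by_cases hω : ω ∈ G <;> simp [hω]
  rw [Measure.map_apply mE hA, Measure.map_apply mF hA, hpre, hpre]
  have hc : P Eᶜ = P Fᶜ := by rw [prob_compl_eq_one_sub hE, prob_compl_eq_one_sub hF, h]
  by_cases h1 : (1 : ℝ) ∈ A <;> by_cases h0 : (0 : ℝ) ∈ A
  · simp [h1, h0, em]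
  · simpa [h1, h0] using h
  · simp only [h1, h0, and_false, and_true, false_or]
    exact hc
  · simp [h1, h0]

lemma bddInProbability_sqrt_smul_empiricalMoments_sub [IsProbabilityMeasure P] {α θ q v : ℝ}
    {d : ℕ}
    (h1 : BddInProbability P fun n ω => Real.sqrt n *
      ((∑ k ∈ Finset.range n, deathIndicator N S k ω) / n - q))
    (h2 : BddInProbability P fun n ω => Real.sqrt n *
      ((∑ k ∈ Finset.range n, centeredLog α θ (S k ω)) / n - 0))
    (h3 : BddInProbability P fun n ω => Real.sqrt n *
      ((∑ k ∈ Finset.range n, centeredLog α θ (S k ω) ^ 2) / n - v))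
    (h4 : Tendsto (fun n : ℕ => Real.sqrt n * ((n : ℝ) / (n - d) - 1)) atTop (𝓝 0)) :
    BddInProbability P fun n ω =>
      Real.sqrt n • (empiricalMoments α θ d N S n ω - (q, 0, v, 1)) :=
  h1.prodMk (h2.prodMk (h3.prodMk (bddInProbability_const_of_tendsto h4)))

/-- The ratio differs from 1 by d/(n - d) ≤ 2d/n for n > 2d, so the choice of divisor is invisible
at scale √n. -/
lemma tendsto_sqrt_mul_div_sub_one (d : ℕ) :
    Tendsto (fun n : ℕ => Real.sqrt n * ((n : ℝ) / (n - d) - 1)) atTop (𝓝 0) := by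
  have hlim : Tendsto (fun n : ℕ => 2 * d / Real.sqrt n) atTop (𝓝 0) :=
    tendsto_const_nhds.div_atTop (Real.tendsto_sqrt_atTop.comp tendsto_natCast_atTop_atTop)
  refine squeeze_zero' ?_ ?_ hlim
  all_goals
    filter_upwards [eventually_ge_atTop (2 * d + 1)] with n hn
    have hn' : 2 * (d : ℝ) + 1 ≤ n := by exact_mod_cast hn
    have hd : (0 : ℝ) ≤ d := by positivity
    have hnd : 0 < (n : ℝ) - d := by linarith
    have heq : (n : ℝ) / (n - d) - 1 = d / (n - d) := by field_simp; ring
    rw [heq]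
  · positivity
  · have hsq : 0 < Real.sqrt n := Real.sqrt_pos.2 (by linarith)
    rw [le_div_iff₀ hsq, mul_right_comm, Real.mul_self_sqrt (by linarith), mul_div_assoc',
      div_le_iff₀ hnd]
    nlinarith

end EventData

/-! ### The central limit theorem for the linearization, and the conclusion. -/

section AsymptoticNormality

variable {Ω : Type*} {N : ℝ → Ω → ℤ} {S : ℕ → Ω → ℝ} {α lam mu : ℝ}

/-- The linearization of `muHat`, evaluated at the data of one event. -/
noncomputable def muInfluence (α θ q : ℝ) (N : ℝ → Ω → ℤ) (S : ℕ → Ω → ℝ) (k : ℕ) (ω : Ω) : ℝ :=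
  θ * (deathIndicator N S k ω - q) + q * thetaInfluence α θ (S k ω)

lemma deathIndicator_sq (k : ℕ) : deathIndicator N S k ^ 2 = deathIndicator N S k := by
  ext ω
  by_cases h : step N S k ω = -1 <;> simp [deathIndicator, h]

/-- Identifies the sum in the central limit theorem with n times the derivative at the empirical
deviation, apart from the deterministic fourth coordinate. -/
lemma sum_muInfluence {θ q : ℝ} {n : ℕ} (hn : n ≠ 0) (d : ℕ) (ω : Ω) :
    ∑ k ∈ Finset.range n, muInfluence α θ q N S k ω =
      n * (θ * ((empiricalMoments α θ d N S n ω).1 - q) +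
        q * (θ * (-(α * (empiricalMoments α θ d N S n ω).2.1) +
          varianceSlope α θ * ((empiricalMoments α θ d N S n ω).2.2.1 - logVariance α)))) := by
  have hn' : (n : ℝ) ≠ 0 := by exact_mod_cast hn
  simp only [muInfluence, thetaInfluence, empiricalMoments, Finset.sum_add_distrib,
    Finset.sum_sub_distrib, ← Finset.mul_sum, Finset.sum_neg_distrib, Finset.sum_const,
    Finset.card_range, nsmul_eq_mul]
  field_simp

variable [MeasurableSpace Ω] {P : Measure Ω}

namespace IsFractionalBirthDeath

lemma measurableSet_death (h : IsFractionalBirthDeath P α lam mu N S) (k : ℕ) :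
    MeasurableSet {ω | step N S k ω = -1} :=
  h.measurable_step k (measurableSet_singleton (-1))

lemma measurable_deathIndicator (h : IsFractionalBirthDeath P α lam mu N S) (k : ℕ) :
    Measurable (deathIndicator N S k) :=
  measurable_one.indicator (h.measurableSet_death k)

lemma identDistrib_sojourn (h : IsFractionalBirthDeath P α lam mu N S) (k : ℕ) :
    IdentDistrib (S k) (S 0) P P :=
  ⟨(h.measurable_sojourn k).aemeasurable, (h.measurable_sojourn 0).aemeasurable,
    (h.sojourn_law k).eq (h.sojourn_law 0)⟩

lemma iIndepFun_deathIndicator (h : IsFractionalBirthDeath P α lam mu N S) :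
    iIndepFun (deathIndicator N S) P :=
  h.indep_step.comp (fun _ => ({-1} : Set ℤ).indicator (1 : ℤ → ℝ)) fun _ => .of_discrete

lemma indepFun_sojourn_deathIndicator (h : IsFractionalBirthDeath P α lam mu N S) (k : ℕ) :
    IndepFun (S k) (deathIndicator N S k) P :=
  h.indep_sojourn_step.comp (measurable_pi_apply k)
    ((Measurable.of_discrete (f := ({-1} : Set ℤ).indicator (1 : ℤ → ℝ))).comp
      (measurable_pi_apply k))

lemma integral_deathIndicator (h : IsFractionalBirthDeath P α lam mu N S) (k : ℕ) :
    ∫ ω, deathIndicator N S k ω ∂P = mu / (lam + mu) := by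
  rw [deathIndicator, integral_indicator_one (h.measurableSet_death k), h.death_prob]

lemma iIndepFun_muInfluence (h : IsFractionalBirthDeath P α lam mu N S) (θ q : ℝ) :
    iIndepFun (muInfluence α θ q N S) P := by
  have hpair := iIndepFun_prodMk h.measurable_sojourn h.measurable_step h.indep_sojourn
    h.indep_step h.indep_sojourn_step
  have hD : Measurable (({-1} : Set ℤ).indicator (1 : ℤ → ℝ)) := .of_discrete
  have hB := measurable_thetaInfluence (α := α) (θ := θ)
  exact hpair.comp (fun _ x => θ * (({-1} : Set ℤ).indicator (1 : ℤ → ℝ) x.2 - q) +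
    q * thetaInfluence α θ x.1) fun _ => by fun_prop

lemma memLp_thetaInfluence (h : IsFractionalBirthDeath P α lam mu N S) (hα : 0 < α)
    (hθ : 0 < lam + mu) (k : ℕ) :
    MemLp (fun ω => thetaInfluence α (lam + mu) (S k ω)) 2 P :=
  ((h.sojourn_law k).memLp_thetaInfluence hα hθ).comp_of_map (h.measurable_sojourn k).aemeasurable

lemma integral_thetaInfluence (h : IsFractionalBirthDeath P α lam mu N S) (hα : 0 < α)
    (hθ : 0 < lam + mu) (k : ℕ) :
    ∫ ω, thetaInfluence α (lam + mu) (S k ω) ∂P = 0 := by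
  rw [← integral_map (f := thetaInfluence α (lam + mu)) (h.measurable_sojourn k).aemeasurable
    measurable_thetaInfluence.aestronglyMeasurable]
  exact (h.sojourn_law k).integral_thetaInfluence hα hθ

lemma measurable_muHat (h : IsFractionalBirthDeath P α lam mu N S) (d n : ℕ) :
    Measurable (muHat d N S n) := by
  have hS := h.measurable_sojourn
  have hD := h.measurable_deathIndicator
  have hmean : Measurable (logMean S n) := by unfold logMean; fun_prop
  have hvar : Measurable (logVar d S n) := by unfold logVar; fun_prop
  unfold muHat thetaHat alphaHat
  simp_rw [cast_numDeaths]
  fun_prop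

lemma variance_thetaInfluence (h : IsFractionalBirthDeath P α lam mu N S) (hα : 0 < α)
    (hθ : 0 < lam + mu) (k : ℕ) :
    Var[fun ω => thetaInfluence α (lam + mu) (S k ω); P] = sigmaThetaSq α (lam + mu) := by
  rw [variance_of_integral_eq_zero
    (X := fun ω => thetaInfluence α (lam + mu) (S k ω))
    (measurable_thetaInfluence.comp (h.measurable_sojourn k)).aemeasurable
    (h.integral_thetaInfluence hα hθ k),
    ← integral_map (f := fun t => thetaInfluence α (lam + mu) t ^ 2)
      (h.measurable_sojourn k).aemeasurable
      (measurable_thetaInfluence.pow_const 2).aestronglyMeasurable]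
  exact (h.sojourn_law k).integral_thetaInfluence_sq hα hθ

lemma sigmaThetaSq_nonneg (h : IsFractionalBirthDeath P α lam mu N S) (hα : 0 < α)
    (hθ : 0 < lam + mu) : 0 ≤ sigmaThetaSq α (lam + mu) := by
  rw [← h.variance_thetaInfluence hα hθ 0]
  exact variance_nonneg _ _

variable [IsProbabilityMeasure P]

lemma identDistrib_deathIndicator (h : IsFractionalBirthDeath P α lam mu N S) (k : ℕ) :
    IdentDistrib (deathIndicator N S k) (deathIndicator N S 0) P P := by
  refine identDistrib_indicator_one (h.measurableSet_death k) (h.measurableSet_death 0) ?_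
  rw [← measureReal_eq_measureReal_iff, h.death_prob, h.death_prob]

lemma memLp_deathIndicator (h : IsFractionalBirthDeath P α lam mu N S) (k : ℕ) :
    MemLp (deathIndicator N S k) 2 P :=
  memLp_indicator_const 2 (h.measurableSet_death k) 1 (Or.inr (measure_ne_top _ _))

lemma variance_deathIndicator (h : IsFractionalBirthDeath P α lam mu N S) (k : ℕ) :
    Var[deathIndicator N S k; P] = mu / (lam + mu) - (mu / (lam + mu)) ^ 2 := by
  rw [variance_eq_sub (h.memLp_deathIndicator k), deathIndicator_sq, h.integral_deathIndicator]

lemma identDistrib_muInfluence (h : IsFractionalBirthDeath P α lam mu N S) (θ q : ℝ) (k : ℕ) :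
    IdentDistrib (muInfluence α θ q N S k) (muInfluence α θ q N S 0) P P := by
  have hB := measurable_thetaInfluence (α := α) (θ := θ)
  exact ((h.identDistrib_sojourn k).prodMk (h.identDistrib_deathIndicator k)
    (h.indepFun_sojourn_deathIndicator k) (h.indepFun_sojourn_deathIndicator 0)).comp
    (u := fun x => θ * (x.2 - q) + q * thetaInfluence α θ x.1) (by fun_prop)

lemma memLp_muInfluence (h : IsFractionalBirthDeath P α lam mu N S) (hα : 0 < α)
    (hθ : 0 < lam + mu) (q : ℝ) (k : ℕ) : MemLp (muInfluence α (lam + mu) q N S k) 2 P :=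
  (((h.memLp_deathIndicator k).sub (memLp_const q)).const_mul _).add
    ((h.memLp_thetaInfluence hα hθ k).const_mul q)

lemma integral_muInfluence (h : IsFractionalBirthDeath P α lam mu N S) (hα : 0 < α)
    (hθ : 0 < lam + mu) (k : ℕ) :
    ∫ ω, muInfluence α (lam + mu) (mu / (lam + mu)) N S k ω ∂P = 0 := by
  have hD := (h.memLp_deathIndicator k).integrable one_le_two
  have hB := (h.memLp_thetaInfluence hα hθ k).integrable one_le_two
  simp only [muInfluence]
  rw [integral_add (by fun_prop) (by fun_prop),
    integral_const_mul, integral_const_mul, integral_sub hD (integrable_const _),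
    h.integral_deathIndicator, h.integral_thetaInfluence hα hθ]
  simp

/-- The death indicator and the time of an event are independent, so variances add: θ² q(1 - q) + q²
σ_θ² with q = 1 - p. -/
lemma variance_muInfluence (h : IsFractionalBirthDeath P α lam mu N S) (hα : 0 < α)
    (hθ : 0 < lam + mu) (k : ℕ) :
    Var[muInfluence α (lam + mu) (mu / (lam + mu)) N S k; P] =
      muVariance α (lam + mu) (lam / (lam + mu)) := by
  have hB := measurable_thetaInfluence (α := α) (θ := lam + mu)
  have hind : IndepFun (fun ω => (lam + mu) * (deathIndicator N S k ω - mu / (lam + mu)))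
      (fun ω => mu / (lam + mu) * thetaInfluence α (lam + mu) (S k ω)) P :=
    (h.indepFun_sojourn_deathIndicator k).symm.comp
      (φ := fun x => (lam + mu) * (x - mu / (lam + mu)))
      (ψ := fun t => mu / (lam + mu) * thetaInfluence α (lam + mu) t) (by fun_prop) (by fun_prop)
  have hsum := hind.variance_fun_add
    (((h.memLp_deathIndicator k).sub (memLp_const _)).const_mul _)
    ((h.memLp_thetaInfluence hα hθ k).const_mul _)
  refine hsum.trans ?_
  simp only [Pi.sub_def]
  rw [variance_const_mul, variance_const_mul,
    variance_sub_const (h.measurable_deathIndicator k).aestronglyMeasurable,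
    h.variance_deathIndicator, h.variance_thetaInfluence hα hθ, muVariance]
  have : lam / (lam + mu) = 1 - mu / (lam + mu) := by field_simp; ring
  rw [this]
  ring

lemma bddInProbability_centeredLog_pow (h : IsFractionalBirthDeath P α lam mu N S) (hα : 0 < α)
    (hθ : 0 < lam + mu) (j : ℕ) :
    BddInProbability P fun n ω => Real.sqrt n *
      ((∑ k ∈ Finset.range n, centeredLog α (lam + mu) (S k ω) ^ j) / n -
        ∫ t, centeredLog α (lam + mu) t ^ j ∂(P.map (S 0))) := by
  have hmeas : Measurable fun t => centeredLog α (lam + mu) t ^ j :=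
    measurable_centeredLog.pow_const j
  rw [integral_map (h.measurable_sojourn 0).aemeasurable hmeas.aestronglyMeasurable]
  refine bddInProbability_sqrt_mul_mean_sub
    (X := fun k ω => centeredLog α (lam + mu) (S k ω) ^ j) ?_
    (h.indep_sojourn.comp (fun _ t => centeredLog α (lam + mu) t ^ j) fun _ => hmeas)
    fun k => (h.identDistrib_sojourn k).comp hmeas
  refine MemLp.comp_of_map (f := S 0) (g := fun t => centeredLog α (lam + mu) t ^ j) ?_
    (h.measurable_sojourn 0).aemeasurable
  rw [memLp_two_iff_integrable_sq hmeas.aestronglyMeasurable]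
  simp_rw [← pow_mul]
  exact (h.sojourn_law 0).integrable_centeredLog_pow hα hθ _

lemma bddInProbability_empiricalMoments (h : IsFractionalBirthDeath P α lam mu N S) (hα : 0 < α)
    (hθ : 0 < lam + mu) (d : ℕ) :
    BddInProbability P fun n ω => Real.sqrt n •
      (empiricalMoments α (lam + mu) d N S n ω - (mu / (lam + mu), 0, logVariance α, 1)) := by
  obtain ⟨m1, m2, -, -⟩ := (h.sojourn_law 0).moments_centeredLog hα hθ
  have h1 := h.bddInProbability_centeredLog_pow hα hθ 1
  have h2 := h.bddInProbability_centeredLog_pow hα hθ 2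
  have hD := bddInProbability_sqrt_mul_mean_sub (h.memLp_deathIndicator 0)
    h.iIndepFun_deathIndicator h.identDistrib_deathIndicator
  simp only [pow_one, m1] at h1
  rw [m2] at h2
  rw [h.integral_deathIndicator] at hD
  exact bddInProbability_sqrt_smul_empiricalMoments_sub hD h1 h2 (tendsto_sqrt_mul_div_sub_one d)

end IsFractionalBirthDeath

variable [IsProbabilityMeasure P]

lemma IsFractionalBirthDeath.tendstoInDistribution_muHat
    (h : IsFractionalBirthDeath P α lam mu N S) (hα : 0 < α) (hθ : 0 < lam + mu) (d : ℕ) :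
    TendstoInDistribution (fun (n : ℕ) ω => Real.sqrt n * (muHat d N S n ω - mu)) atTop
      (id : ℝ → ℝ) (fun _ => P)
      (gaussianReal 0 (muVariance α (lam + mu) (lam / (lam + mu))).toNNReal) := by
  set θ := lam + mu with hθdef
  set q := mu / θ with hq
  have hqθ : q * θ = mu := by rw [hq]; field_simp
  have hclt := tendstoInDistribution_inv_sqrt_mul_sum_sub (P := P)
    (X := muInfluence α θ q N S) (Y := (id : ℝ → ℝ))
    (P' := gaussianReal 0 (muVariance α θ (lam / θ)).toNNReal)
    (by rw [h.variance_muInfluence hα hθ]; exact ⟨aemeasurable_id, Measure.map_id⟩)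
    (h.memLp_muInfluence hα hθ q 0) (h.iIndepFun_muInfluence θ q)
    (h.identDistrib_muInfluence θ q)
  obtain ⟨A, hA, hAval⟩ := hasFDerivAt_momentEstimator (q := q) hα hθ
  have hrem := tendstoInMeasure_sqrt_mul_remainder hA (h.bddInProbability_empiricalMoments hα hθ d)
  -- The contribution of the fourth coordinate to the derivative, absent from `muInfluence`,
  -- vanishes in the limit.
  have hdet0 := (tendsto_sqrt_mul_div_sub_one d).const_mul
    (q * θ * varianceSlope α θ * logVariance α)
  rw [mul_zero] at hdet0
  have hdet := tendstoInMeasure_const_of_tendsto (P := P) hdet0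
  -- Slutsky: the rescaled error differs from the normalized sum by the delta-method remainder plus
  -- the deterministic term, both tending to 0 in probability.
  refine tendstoInDistribution_of_tendstoInMeasure_sub _ _ hclt ?_ fun n =>
    (((h.measurable_muHat d n).sub_const mu).const_mul _).aemeasurable
  refine (tendstoInMeasure_add hrem hdet).congr' ?_ EventuallyEq.rfl
  filter_upwards [eventually_ne_atTop 0] with n hn
  refine ae_of_all _ fun ω => ?_
  have hn' : (0 : ℝ) < n := by exact_mod_cast Nat.pos_of_ne_zero hn
  have hsq : Real.sqrt n * Real.sqrt n = n := Real.mul_self_sqrt hn'.le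
  have hsq0 : Real.sqrt n ≠ 0 := (Real.sqrt_pos.2 hn').ne'
  have hmean : ∫ ω, muInfluence α θ q N S 0 ω ∂P = 0 := h.integral_muInfluence hα hθ 0
  have hr : (empiricalMoments α θ d N S n ω).2.2.2 = (n : ℝ) / (n - d) := rfl
  simp only [Pi.sub_apply]
  rw [hAval, momentEstimator_apply hα hθ, ← muHat_eq d hn, sum_muInfluence hn d, hmean,
    mul_zero, sub_zero, ← hr]
  simp only [Prod.fst_sub, Prod.snd_sub, sub_zero]
  generalize empiricalMoments α θ d N S n ω = z
  have hinv : (Real.sqrt n)⁻¹ * n = Real.sqrt n := by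
    rw [inv_mul_eq_div, div_eq_iff hsq0, hsq]
  rw [← mul_assoc (Real.sqrt n)⁻¹, hinv]
  linear_combination (-Real.sqrt n) * hqθ

end AsymptoticNormality

end FractionalQueue

theorem mainTheorem8 {Ω : Type*} [MeasurableSpace Ω] (P : MeasureTheory.Measure Ω)
    [MeasureTheory.IsProbabilityMeasure P]
    (α lam mu θ p : ℝ) (hα0 : 0 < α) (hα1 : α ≤ 1) (hlam : 0 < lam) (hmu : 0 < mu)
    (hθ : θ = lam + mu) (hp : p = lam / θ)
    (N : ℝ → Ω → ℤ) (S : ℕ → Ω → ℝ)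
    (hN : FractionalQueue.IsFractionalBirthDeath P α lam mu N S)
    (d : ℕ) (hd : d ≤ 1) :
    0 ≤ FractionalQueue.sigmaThetaSq α θ ∧
    MeasureTheory.TendstoInDistribution
      (fun (n : ℕ) (ω : Ω) => Real.sqrt n * (FractionalQueue.muHat d N S n ω - mu))
      Filter.atTop
      (id : ℝ → ℝ)
      (fun _ => P)
      (ProbabilityTheory.gaussianReal 0
        (Real.toNNReal (FractionalQueue.muVariance α θ p))) := by
  subst hθ hp
  have hθ : 0 < lam + mu := by linarith
  exact ⟨hN.sigmaThetaSq_nonneg hα0 hθ, hN.tendstoInDistribution_muHat hα0 hθ d⟩
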